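/- Let $n,p$ be positive integers. Let $\mathcal{C}\ell_p$ be the complex Clifford algebra with generators $e_1,\dots,e_p$, $e_\alpha e_\beta+e_\beta e_\alpha=2\delta_{\alpha,\beta}$, and let $\mathcal{A}=\mathbb{C}[x_{i,\alpha}: 1\le i\le n,\ 1\le\alpha\le p]\otimes\mathcal{C}\ell_p$. The monomials $x^\gamma e^\eta=\prod_{i,\alpha}x_{i,\alpha}^{\gamma_{i,\alpha}}\, e_1^{\eta_1}\cdots e_p^{\eta_p}$, with $\gamma\in M_{n,p}(\mathbb{N}_0)$ and $\eta\in\{0,1\}^p$, form a basis of $\mathcal{A}$; let $\langle\cdot,\cdot\rangle$ be the inner product on $\mathcal{A}$, linear in the second argument, for which this basis is orthonormal. The odd generators $B_i^+,B_i^-$ ($1\le i\le n$) of the Lie superalgebra $\mathfrak{osp}(1|2n)$ act on $\mathcal{A}$ by $X_i=\sum_\alpha x_{i,\alpha}e_\alpha$ and $D_i=\sum_\alpha\partial_{x_{i,\alpha}}e_\alpha$ (with $e_\alpha$ acting by left multiplication). Let $L_n(p)\subseteq\mathcal{A}$ be the submodule generated by $1$, and for $\mu\in\mathbb{N}_0^n$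 let $L_n(p)_{\mu+p/2}$ be the space of all $v\in L_n(p)$ with $\tfrac12(X_iD_i+D_iX_i)v=(\mu_i+\tfrac p2)v$ for all $i$; put $d_\mu=\dim L_n(p)_{\mu+p/2}$. Let $\mathbb{Y}_n(p)$ be the set of semistandard Young tableaux with entries in $\{1,\dots,n\}$ and at most $p$ rows. For $A\in\mathbb{Y}_n(p)$ let $\lambda_A$ be its shape, $\mu_A\in\mathbb{N}_0^n$ its weight ($(\mu_A)_i$ is the number of entries $i$), and $A^k$ the subtableau of the entries $\le k$. Order $\mathbb{Y}_n(p)$ by: $A<B$ if $\mu_A<\mu_B$, or if $\mu_A=\mu_B$ and for some $k\in\{1,\dots,n\}$ one has $\lambda_{A^l}=\lambda_{B^l}$ for all $l<k$ and $\lambda_{A^k}<\lambda_{B^k}$; here elements of $\mathbb{N}_0^n$ and partitions are compared in the graded lexicographic order (first by the sum of the parts, then by the first part that differs). For $i_1<\dots<i_k$ put $X_{(i_1,\dots,i_k)}=\sum_{\sigma\in S_k}\operatorname{sgn}(\sigma)X_{i_{\sigma(1)}}\cdots X_{i_{\sigma(k)}}$. If $a_1,\dots,a_m$ are the columns of $A$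 from left to right and $h_1,\dots,h_m$ are their lengths, put $$\tilde\omega_A(p)=\frac{1}{h_1!\cdots h_m!}\,X_{a_m}\cdots X_{a_1}(1)\in L_n(p).$$ The leading term of $\tilde\omega_A(p)$ is $t_A=x_{A,D_A}\,e_{D_A}$, where $x_{A,D_A}$ is the product of $x_{a,k}$ over all boxes of $A$, $a$ being the entry and $k$ the row of the box, and $e_{D_A}=(e_1\cdots e_{h_m})\cdots(e_1\cdots e_{h_1})$. Then the following hold. 1. For every $\mu\in\mathbb{N}_0^n$ there are exactly $d_\mu$ tableaux of weight $\mu$ in $\mathbb{Y}_n(p)$; denote them by $A_1<\dots<A_{d_\mu}$. The $d_\mu\times d_\mu$ matrix $U_\mu$ with entries $(U_\mu)_{k,l}=\langle t_{A_k},\tilde\omega_{A_l}(p)\rangle$ is an integer upper unitriangular matrix. 2. For every $v\in L_n(p)_{\mu+p/2}$, with $f_\mu(v)\in\mathbb{C}^{d_\mu}$ defined by $(f_\mu)_k(v)=\langle t_{A_k},v\rangle$, $$v=\sum_{k=1}^{d_\mu}\big(U_\mu^{-1}f_\mu(v)\big)_k\,\tilde\omega_{A_k}(p)=\sum_{k=1}^{d_\mu}\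 \sum_{t=0}^{d_\mu-k}\ \sum_{k=l_0<l_1<\cdots<l_t\le d_\mu}(-1)^t\Big(\prod_{s=1}^{t}(U_\mu)_{l_{s-1},l_s}\Big)(f_\mu)_{l_t}(v)\,\tilde\omega_{A_k}(p).$$ 3. All generator matrix elements are integers: for all $i\in\{1,\dots,n\}$ and $A\in\mathbb{Y}_n(p)$, each of $X_i\tilde\omega_A(p)$ and $D_i\tilde\omega_A(p)$ is a finite linear combination of the vectors $\tilde\omega_B(p)$, $B\in\mathbb{Y}_n(p)$, with uniquely determined complex coefficients, and these coefficients are integers. -/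

import Mathlib

open scoped TensorProduct

namespace Paraboson

noncomputable section

/-! ### The Clifford algebra and its monomial basis -/

/-- The quadratic form `v ↦ v₁² + ⋯ + v_p²` on `ℂ^p`. -/
def cliffordForm (p : ℕ) : QuadraticForm ℂ (Fin p → ℂ) :=
  QuadraticMap.weightedSumSquares ℂ (fun _ : Fin p => (1 : ℂ))

/-- The complex Clifford algebra with `p` generators `e_α`, `{e_α, e_β} = 2 δ_{αβ}`. -/
abbrev Cl (p : ℕ) : Type := CliffordAlgebra (cliffordForm p)

/-- The generator `e_α`. -/
def e {p : ℕ} (α : Fin p) : Cl p := CliffordAlgebra.ι (cliffordForm p) (Pi.single α 1)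

theorem e_anticomm {p : ℕ} (α β : Fin p) :
    e α * e β + e β * e α = if α = β then 2 else 0 := by
  unfold e
  rw [CliffordAlgebra.ι_mul_ι_add_swap]
  have key : QuadraticMap.polar (cliffordForm p) (Pi.single α 1) (Pi.single β 1)
      = if α = β then 2 else 0 := by
    simp only [QuadraticMap.polar, cliffordForm, QuadraticMap.weightedSumSquares_apply,
      Pi.add_apply, one_smul]
    rw [← Finset.sum_sub_distrib, ← Finset.sum_sub_distrib]
    have : ∀ i : Fin p, ((Pi.single α (1 : ℂ) : Fin p → ℂ) i + (Pi.single β 1 : Fin p → ℂ) i) *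
        ((Pi.single α (1 : ℂ) : Fin p → ℂ) i + (Pi.single β 1 : Fin p → ℂ) i)
        - (Pi.single α (1 : ℂ) : Fin p → ℂ) i * (Pi.single α (1 : ℂ) : Fin p → ℂ) i
        - (Pi.single β (1 : ℂ) : Fin p → ℂ) i * (Pi.single β (1 : ℂ) : Fin p → ℂ) i
        = if i = α then (if α = β then 2 else 0) else 0 := by
      intro i
      by_cases h1 : i = α
      · subst h1
        by_cases h2 : i = β
        · subst h2
          norm_num
        · simp [h2]
      · simp [h1]
    rw [Finset.sum_congr rfl fun i _ => this i]
    simp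
  rw [key]
  split_ifs
  · exact map_ofNat _ 2
  · exact map_zero _

/-- The ordered monomial `e^η = e_1^{η_1} ⋯ e_p^{η_p}`. -/
def cliffordMonomial {p : ℕ} (η : Fin p → ℕ) : Cl p :=
  (List.ofFn fun α => e α ^ η α).prod

/-- Left multiplication by `e_α` in coordinates with respect to the monomials `e^η`, `η ∈ ℤ₂^p`
(an auxiliary operator, used only to show that these monomials are linearly independent). -/
def coordMul {p : ℕ} (α : Fin p) : Module.End ℂ ((Fin p → ZMod 2) → ℂ) where
  toFun f η := (∏ β : Fin p, if β < α then (-1 : ℂ) ^ (η β).val else 1) * f (η + Pi.single α 1)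
  map_add' f g := by ext η; simp [mul_add]
  map_smul' c f := by ext η; simp; ring

theorem coordMul_apply {p : ℕ} (α : Fin p) (f : (Fin p → ZMod 2) → ℂ) (η : Fin p → ZMod 2) :
    coordMul α f η
      = (∏ β : Fin p, if β < α then (-1 : ℂ) ^ (η β).val else 1) * f (η + Pi.single α 1) := rfl

theorem neg_one_pow_val_add_one (a : ZMod 2) :
    (-1 : ℂ) ^ (a + 1).val = - (-1 : ℂ) ^ a.val := by
  fin_cases a
  · have : ((0 : ZMod 2) + 1).val = 1 := by decide
    change (-1 : ℂ) ^ ((0 : ZMod 2) + 1).val = - (-1 : ℂ) ^ (0 : ZMod 2).val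
    rw [this, ZMod.val_zero]; norm_num
  · have : ((1 : ZMod 2) + 1).val = 0 := by decide
    have h1 : (1 : ZMod 2).val = 1 := by decide
    change (-1 : ℂ) ^ ((1 : ZMod 2) + 1).val = - (-1 : ℂ) ^ (1 : ZMod 2).val
    rw [this, h1]; norm_num

theorem sign_shift_ge {p : ℕ} {α β : Fin p} (h : α ≤ β) (η : Fin p → ZMod 2) :
    (∏ γ : Fin p, if γ < α then (-1 : ℂ) ^ ((η + Pi.single β 1 : Fin p → ZMod 2) γ).val else 1)
      = ∏ γ : Fin p, if γ < α then (-1 : ℂ) ^ (η γ).val else 1 := by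
  refine Finset.prod_congr rfl fun γ _ => ?_
  split_ifs with hγ
  · have : γ ≠ β := (lt_of_lt_of_le hγ h).ne
    simp [this]
  · rfl

theorem sign_shift_lt {p : ℕ} {α β : Fin p} (h : β < α) (η : Fin p → ZMod 2) :
    (∏ γ : Fin p, if γ < α then (-1 : ℂ) ^ ((η + Pi.single β 1 : Fin p → ZMod 2) γ).val else 1)
      = - ∏ γ : Fin p, if γ < α then (-1 : ℂ) ^ (η γ).val else 1 := by
  rw [← Finset.mul_prod_erase _ _ (Finset.mem_univ β),
    ← Finset.mul_prod_erase (a := β) _ (fun γ => if γ < α then (-1 : ℂ) ^ (η γ).val else 1)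
      (Finset.mem_univ β)]
  have h2 : ∀ γ ∈ Finset.univ.erase β,
      (if γ < α then (-1 : ℂ) ^ ((η + Pi.single β 1 : Fin p → ZMod 2) γ).val else 1)
        = if γ < α then (-1 : ℂ) ^ (η γ).val else 1 := by
    intro γ hγ
    have : γ ≠ β := Finset.ne_of_mem_erase hγ
    simp [this]
  rw [Finset.prod_congr rfl h2]
  simp only [h, if_true, Pi.add_apply, Pi.single_eq_same, neg_one_pow_val_add_one]
  ring

theorem shift_shift {p : ℕ} (α : Fin p) (η : Fin p → ZMod 2) :
    η + Pi.single α 1 + Pi.single α 1 = η := by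
  rw [add_assoc, ← Pi.single_add]
  have : (1 : ZMod 2) + 1 = 0 := by decide
  simp [this]

theorem coordMul_sq {p : ℕ} (α : Fin p) : coordMul α * coordMul α = 1 := by
  refine LinearMap.ext fun f => funext fun η => ?_
  change coordMul α (coordMul α f) η = f η
  rw [coordMul_apply, coordMul_apply, sign_shift_ge le_rfl, shift_shift, ← mul_assoc,
    ← Finset.prod_mul_distrib, Finset.prod_eq_one, one_mul]
  intro γ _
  split_ifs
  · rw [← mul_pow]; norm_num
  · norm_num

theorem coordMul_anticomm {p : ℕ} {α β : Fin p} (h : α ≠ β) :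
    coordMul α * coordMul β + coordMul β * coordMul α = 0 := by
  wlog hlt : α < β generalizing α β
  · rw [add_comm]
    exact this h.symm (lt_of_le_of_ne (not_lt.mp hlt) h.symm)
  refine LinearMap.ext fun f => funext fun η => ?_
  change coordMul α (coordMul β f) η + coordMul β (coordMul α f) η = 0
  rw [coordMul_apply, coordMul_apply, coordMul_apply, coordMul_apply, sign_shift_lt hlt,
    sign_shift_ge hlt.le, add_right_comm η (Pi.single β 1)]
  ring

/-- The linear combination `∑ v_α (coordMul α)`. -/
def coordLin (p : ℕ) : (Fin p → ℂ) →ₗ[ℂ] Module.End ℂ ((Fin p → ZMod 2) → ℂ) :=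
  Fintype.linearCombination ℂ (fun α : Fin p => coordMul α)

theorem coordLin_sq {p : ℕ} (v : Fin p → ℂ) :
    coordLin p v * coordLin p v = algebraMap ℂ _ (cliffordForm p v) := by
  have h2 : (2 : ℂ) • (coordLin p v * coordLin p v)
      = (2 : ℂ) • algebraMap ℂ (Module.End ℂ ((Fin p → ZMod 2) → ℂ)) (cliffordForm p v) := by
    have e1 : coordLin p v * coordLin p v
        = ∑ α, ∑ β, (v α * v β) • (coordMul α * coordMul β) := by
      simp only [coordLin, Fintype.linearCombination_apply, Finset.sum_mul_sum, smul_mul_smul_comm]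
    have e2 : coordLin p v * coordLin p v
        = ∑ α, ∑ β, (v α * v β) • (coordMul β * coordMul α) := by
      rw [e1, Finset.sum_comm]
      refine Finset.sum_congr rfl fun α _ => Finset.sum_congr rfl fun β _ => ?_
      rw [mul_comm]
    rw [two_smul]
    nth_rewrite 1 [e1]
    rw [e2, ← Finset.sum_add_distrib]
    have e3 : ∀ α : Fin p, (∑ β, (v α * v β) • (coordMul α * coordMul β)
        + ∑ β, (v α * v β) • (coordMul β * coordMul α)) = (2 * (v α * v α)) • 1 := by
      intro α
      rw [← Finset.sum_add_distrib, Finset.sum_eq_single α]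
      · rw [coordMul_sq, ← add_smul]; ring_nf
      · intro β _ hβ
        rw [← smul_add, coordMul_anticomm hβ.symm, smul_zero]
      · simp
    rw [Finset.sum_congr rfl fun α _ => e3 α, ← Finset.sum_smul, ← Finset.mul_sum,
      Algebra.algebraMap_eq_smul_one, smul_smul]
    simp [cliffordForm, QuadraticMap.weightedSumSquares_apply]
  exact smul_right_injective _ (two_ne_zero) h2

/-- The coordinates of an element of the Clifford algebra. -/
def cliffordCoord (p : ℕ) : Cl p →ₗ[ℂ] ((Fin p → ZMod 2) → ℂ) :=
  (LinearMap.applyₗ (Pi.single 0 1)).comp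
    (CliffordAlgebra.lift (cliffordForm p) ⟨coordLin p, coordLin_sq⟩).toLinearMap

theorem coordMul_list {p : ℕ} (η : Fin p → ZMod 2) (l : List (Fin p)) (hl : l.Pairwise (· < ·)) :
    (l.map fun α => coordMul α ^ (η α).val).prod (Pi.single 0 1)
      = Pi.single (fun α => if α ∈ l then η α else 0) 1 := by
  induction l with
  | nil =>
    simp
    rfl
  | cons a l ih =>
    rw [List.pairwise_cons] at hl
    obtain ⟨ha, hl⟩ := hl
    rw [List.map_cons, List.prod_cons, Module.End.mul_apply, ih hl]
    have hal : a ∉ l := fun h => lt_irrefl _ (ha a h)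
    have h01 : η a = 0 ∨ η a = 1 := by
      generalize η a = x
      fin_cases x
      · exact Or.inl rfl
      · exact Or.inr rfl
    rcases h01 with h | h
    · rw [h]
      have : (fun α => if α ∈ a :: l then η α else 0) = fun α => if α ∈ l then η α else 0 := by
        funext α
        by_cases hα : α = a
        · subst hα; simp [hal, h]
        · simp [hα]
      rw [this]
      simp
    · rw [h]
      have h1 : (1 : ZMod 2).val = 1 := by decide
      rw [h1, pow_one]
      have key : (fun α => if α ∈ a :: l then η α else 0)
          = (fun α => if α ∈ l then η α else 0) + Pi.single a 1 := by
        funext α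
        by_cases hα : α = a
        · subst hα; simp [hal, h]
        · simp [hα]
      rw [key]
      funext ζ
      rw [coordMul_apply]
      by_cases hζ : ζ = (fun α => if α ∈ l then η α else 0) + Pi.single a 1
      · rw [hζ, shift_shift, Pi.single_eq_same, Pi.single_eq_same, mul_one]
        refine Finset.prod_eq_one fun γ _ => ?_
        split_ifs with hγ
        · have h3 : γ ∉ l := fun h => lt_asymm hγ (ha γ h)
          have h4 : γ ≠ a := hγ.ne
          simp [h3, h4]
        · rfl
      · have h5 : ζ + Pi.single a 1 ≠ (fun α => if α ∈ l then η α else 0) := by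
          intro h6
          apply hζ
          rw [← h6, shift_shift]
        rw [Pi.single_eq_of_ne h5, Pi.single_eq_of_ne hζ, mul_zero]

theorem cliffordCoord_monomial {p : ℕ} (η : Fin p → ZMod 2) :
    cliffordCoord p (cliffordMonomial fun α => (η α).val) = Pi.single η 1 := by
  have h1 : CliffordAlgebra.lift (cliffordForm p) ⟨coordLin p, coordLin_sq⟩
      (cliffordMonomial fun α => (η α).val)
        = ((List.finRange p).map fun α => coordMul α ^ (η α).val).prod := by
    rw [cliffordMonomial, List.ofFn_eq_map, map_list_prod, List.map_map]
    congr 1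
    refine List.map_congr_left fun α _ => ?_
    simp only [Function.comp, map_pow, e, CliffordAlgebra.lift_ι_apply]
    congr 1
    simp [coordLin]
  change CliffordAlgebra.lift (cliffordForm p) ⟨coordLin p, coordLin_sq⟩
      (cliffordMonomial fun α => (η α).val) (Pi.single 0 1) = _
  rw [h1, coordMul_list η _ (List.pairwise_lt_finRange p)]
  simp

theorem finrank_Cl (p : ℕ) : Module.finrank ℂ (Cl p) = Fintype.card (Fin p → ZMod 2) := by
  rw [(CliffordAlgebra.equivExterior (cliffordForm p)).finrank_eq,
    Module.finrank_eq_card_basis (Module.Basis.ExteriorAlgebra (Pi.basisFun ℂ (Fin p)))]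
  simp [ZMod.card]

theorem linearIndependent_cliffordMonomial (p : ℕ) :
    LinearIndependent ℂ
      (fun η : Fin p → ZMod 2 => cliffordMonomial fun α => (η α).val) := by
  apply LinearIndependent.of_comp (cliffordCoord p)
  have : (cliffordCoord p ∘ fun η : Fin p → ZMod 2 => cliffordMonomial fun α => (η α).val)
      = Pi.basisFun ℂ (Fin p → ZMod 2) := by
    funext η
    simp [cliffordCoord_monomial]
  rw [this]
  exact (Pi.basisFun ℂ (Fin p → ZMod 2)).linearIndependent

/-- The basis `e^η`, `η ∈ ℤ₂^p`, of the Clifford algebra. -/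
def cliffordBasis (p : ℕ) : Module.Basis (Fin p → ZMod 2) ℂ (Cl p) :=
  basisOfLinearIndependentOfCardEqFinrank (linearIndependent_cliffordMonomial p)
    (finrank_Cl p).symm

theorem cliffordBasis_apply {p : ℕ} (η : Fin p → ZMod 2) :
    cliffordBasis p η = cliffordMonomial fun α => (η α).val := by
  simp [cliffordBasis]

/-! ### Clifford algebra valued polynomials -/

/-- The space `𝒜 = ℂ[ℝ^{np}] ⊗ 𝒞ℓ_p`; the variable `x_{i,α}` is `MvPolynomial.X (i, α)`. -/
abbrev CliffPoly (n p : ℕ) : Type := MvPolynomial (Fin n × Fin p) ℂ ⊗[ℂ] Cl p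

/-- The monomial `x^γ = ∏_{i,α} x_{i,α}^{γ_{i,α}}`. -/
def polyMonomial {n p : ℕ} (γ : Fin n × Fin p → ℕ) : MvPolynomial (Fin n × Fin p) ℂ :=
  ∏ i : Fin n, ∏ α : Fin p, MvPolynomial.X (i, α) ^ γ (i, α)

/-- The basis of `𝒜` consisting of the monomials `x^γ e^η`. -/
def monomialBasis (n p : ℕ) :
    Module.Basis ((Fin n × Fin p →₀ ℕ) × (Fin p → ZMod 2)) ℂ (CliffPoly n p) :=
  (MvPolynomial.basisMonomials (Fin n × Fin p) ℂ).tensorProduct (cliffordBasis p)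

theorem monomialBasis_apply {n p : ℕ} (γ : Fin n × Fin p →₀ ℕ) (η : Fin p → ZMod 2) :
    monomialBasis n p (γ, η) = polyMonomial γ ⊗ₜ[ℂ] cliffordMonomial fun α => (η α).val := by
  rw [monomialBasis, Module.Basis.tensorProduct_apply, cliffordBasis_apply,
    MvPolynomial.coe_basisMonomials]
  congr 1
  change MvPolynomial.monomial γ 1 = _
  rw [MvPolynomial.monomial_eq, polyMonomial, Finsupp.prod_fintype _ _ (by simp),
    Fintype.prod_prod_type]
  simp

/-- The inner product on `𝒜` (conjugate-linear in the first argument) for which the monomials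
`x^γ e^η` are orthonormal. -/
def pairing {n p : ℕ} (u v : CliffPoly n p) : ℂ :=
  ((monomialBasis n p).repr u).sum fun b c => (starRingEnd ℂ) c * (monomialBasis n p).repr v b

theorem pairing_monomialBasis {n p : ℕ} (b b' : (Fin n × Fin p →₀ ℕ) × (Fin p → ZMod 2)) :
    pairing (monomialBasis n p b) (monomialBasis n p b') = if b = b' then 1 else 0 := by
  classical
  simp [pairing, Finsupp.single_apply, eq_comm]

/-! ### The action of `osp(1|2n)` and the module `L_n(p)` -/

/-- The action of the odd generator `B_i⁺`: `X_i = ∑_α x_{i,α} e_α`. -/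
def X {n p : ℕ} (i : Fin n) : Module.End ℂ (CliffPoly n p) :=
  ∑ α : Fin p, TensorProduct.map
    (LinearMap.mulLeft ℂ (MvPolynomial.X (i, α) : MvPolynomial (Fin n × Fin p) ℂ))
    (LinearMap.mulLeft ℂ (e α))

/-- The action of the odd generator `B_i⁻`: `D_i = ∑_α ∂_{i,α} e_α`. -/
def D {n p : ℕ} (i : Fin n) : Module.End ℂ (CliffPoly n p) :=
  ∑ α : Fin p, TensorProduct.map
    ((MvPolynomial.pderiv (i, α) :
      Derivation ℂ (MvPolynomial (Fin n × Fin p) ℂ) (MvPolynomial (Fin n × Fin p) ℂ)) :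
        MvPolynomial (Fin n × Fin p) ℂ →ₗ[ℂ] MvPolynomial (Fin n × Fin p) ℂ)
    (LinearMap.mulLeft ℂ (e α))

/-- The constant polynomial `1 ∈ 𝒜`. -/
def vac (n p : ℕ) : CliffPoly n p := 1 ⊗ₜ[ℂ] 1

/-- `L_n(p)`: the smallest subspace of `𝒜` that contains `1` and is stable under the action of
`osp(1|2n)`, that is, under its generators `X_i` and `D_i`. -/
def L (n p : ℕ) : Submodule ℂ (CliffPoly n p) :=
  sInf {W | vac n p ∈ W ∧ ∀ i : Fin n, ∀ w ∈ W, X i w ∈ W ∧ D i w ∈ W}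

/-- The action of the Cartan element `h_i = ½ {B_i⁺, B_i⁻}`. -/
def cartan {n p : ℕ} (i : Fin n) : Module.End ℂ (CliffPoly n p) :=
  (1 / 2 : ℂ) • (X i * D i + D i * X i)

/-- The weight space of `L_n(p)` of weight `μ + p/2 = (μ_1 + p/2, …, μ_n + p/2)`. -/
def weightSpace (n p : ℕ) (μ : Fin n → ℕ) : Submodule ℂ (CliffPoly n p) :=
  L n p ⊓ ⨅ i : Fin n, (cartan i).eigenspace ((μ i : ℂ) + (p : ℂ) / 2)

/-- `d_μ = dim L_n(p)_{μ + p/2}`. -/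
def dimWeight (n p : ℕ) (μ : Fin n → ℕ) : ℕ := Module.finrank ℂ (weightSpace n p μ)

/-! ### Semistandard tableaux with entries `1, …, n` and at most `p` rows

Rows, columns and entries are counted from `0`: the entry `i` stands for `i + 1`. -/

/-- The set `𝕐_n(p)` of semistandard Young tableaux with at most `p` rows and `n` admissible
entries. -/
structure Tableau (n p : ℕ) where
  shape : YoungDiagram
  entry : SemistandardYoungTableau shape
  entry_lt : ∀ {r c : ℕ}, (r, c) ∈ shape → entry r c < n
  length_le : shape.colLen 0 ≤ p

namespace Tableau

variable {n p : ℕ}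

/-- The weight `μ_A`: `(μ_A)_i` is the number of entries `i` in `A`. -/
def weight (A : Tableau n p) (i : Fin n) : ℕ :=
  (A.shape.cells.filter fun c => A.entry c.1 c.2 = i).card

/-- The shape `λ_{A^k}` of the `k`-th subtableau, formed by the boxes of `A` that contain one of
the `k` smallest admissible entries. -/
def subshape (A : Tableau n p) (k : ℕ) : YoungDiagram where
  cells := A.shape.cells.filter fun c => A.entry c.1 c.2 < k
  isLowerSet := by
    rintro ⟨r, c⟩ ⟨r', c'⟩ hle h
    obtain ⟨hr, hc⟩ := Prod.mk_le_mk.mp hle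
    simp only [Finset.coe_filter, Set.mem_ofPred_eq, YoungDiagram.mem_cells] at h ⊢
    have hmem : (r', c) ∈ A.shape := A.shape.up_left_mem hr le_rfl h.1
    exact ⟨A.shape.up_left_mem hr hc h.1,
      lt_of_le_of_lt ((A.entry.row_weak_of_le hc hmem).trans (A.entry.col_weak hr h.1)) h.2⟩

/-- The factorial `λ_A! = λ'_1! λ'_2! ⋯`, the product running over the columns. -/
def shapeFactorial (A : Tableau n p) : ℕ :=
  ∏ c ∈ Finset.range (A.shape.rowLen 0), (A.shape.colLen c).factorial

/-- The `c`-th column of `A`, read downwards. -/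
def column (A : Tableau n p) (c : ℕ) (r : Fin (A.shape.colLen c)) : Fin n :=
  ⟨A.entry r c, A.entry_lt (YoungDiagram.mem_iff_lt_colLen.mpr r.isLt)⟩

end Tableau

/-- Graded lexicographic order on `ℕ^n`. -/
def weightLT {n : ℕ} (μ ν : Fin n → ℕ) : Prop :=
  ∑ i, μ i < ∑ i, ν i ∨
    (∑ i, μ i = ∑ i, ν i ∧ ∃ j, (∀ i < j, μ i = ν i) ∧ μ j < ν j)

/-- Graded lexicographic order on partitions. -/
def partitionLT (κ ν : YoungDiagram) : Prop :=
  κ.card < ν.card ∨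
    (κ.card = ν.card ∧ ∃ j, (∀ i < j, κ.rowLen i = ν.rowLen i) ∧ κ.rowLen j < ν.rowLen j)

/-- The order on tableaux: first compare the weights, then the shapes of the subtableaux. -/
instance (n p : ℕ) : LT (Tableau n p) where
  lt A B := weightLT A.weight B.weight ∨
    (A.weight = B.weight ∧ ∃ k ∈ Finset.Icc 1 n,
      (∀ l ∈ Finset.Icc 1 n, l < k → A.subshape l = B.subshape l) ∧
        partitionLT (A.subshape k) (B.subshape k))

/-! ### Tableau vectors and leading terms -/

/-- The operator `X_I = ∑_{σ ∈ S_k} sgn(σ) X_{i_{σ(1)}} ⋯ X_{i_{σ(k)}}`. -/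
def columnOp {n p k : ℕ} (I : Fin k → Fin n) : Module.End ℂ (CliffPoly n p) :=
  ∑ σ : Equiv.Perm (Fin k),
    ((Equiv.Perm.sign σ : ℤ) : ℂ) • (List.ofFn fun r : Fin k => X (I (σ r))).prod

namespace Tableau

variable {n p : ℕ}

/-- `ω_A(p) = X_{a_m} ⋯ X_{a_1}(1)`, where `a_1, …, a_m` are the columns of `A` from left to
right. -/
def omega (A : Tableau n p) : CliffPoly n p :=
  (List.range (A.shape.rowLen 0)).foldl (fun v c => columnOp (A.column c) v) (vac n p)

/-- The normalized tableau vector `ω̃_A(p) = ω_A(p) / λ_A!`. -/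
def omegaTilde (A : Tableau n p) : CliffPoly n p :=
  ((A.shapeFactorial : ℂ))⁻¹ • A.omega

/-- For a filling `C` of the shape of `A` by `1, …, p`: the monomial
`x_{A,C} = ∏_{(k,l)} x_{a_{k,l}, c_{k,l}}`. -/
def xMonomial (A : Tableau n p) (C : A.shape.cells → Fin p) : MvPolynomial (Fin n × Fin p) ℂ :=
  ∏ b : A.shape.cells,
    MvPolynomial.X (⟨A.entry b.1.1 b.1.2, A.entry_lt ((YoungDiagram.mem_cells _).mp b.2)⟩, C b)

/-- For a filling `C` of the shape of `A` by `1, …, p`: the Clifford monomial `e_C`, the product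
of the `e_{c_{k,l}}`, the columns being taken from right to left and each being read downwards. -/
def eMonomial (A : Tableau n p) (C : A.shape.cells → Fin p) : Cl p :=
  (List.ofFn fun c : Fin (A.shape.rowLen 0) =>
    (List.ofFn fun r : Fin (A.shape.colLen c) =>
      e (C ⟨(r, c), (YoungDiagram.mem_cells _).mpr
        (YoungDiagram.mem_iff_lt_colLen.mpr r.isLt)⟩)).prod).reverse.prod

/-- The filling `D_A` all of whose entries in the `k`-th row are `k`. -/
def rowFilling (A : Tableau n p) (b : A.shape.cells) : Fin p :=
  ⟨b.1.1, lt_of_lt_of_le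
    (lt_of_lt_of_le (YoungDiagram.mem_iff_lt_colLen.mp ((YoungDiagram.mem_cells _).mp b.2))
      (A.shape.colLen_anti 0 b.1.2 (Nat.zero_le _))) A.length_le⟩

/-- The leading term `x_{A,D_A} e_{D_A}` of `ω̃_A(p)`. -/
def leadingTerm (A : Tableau n p) : CliffPoly n p :=
  A.xMonomial A.rowFilling ⊗ₜ[ℂ] A.eMonomial A.rowFilling

end Tableau

/-- `A_1 < ⋯ < A_d` are precisely the tableaux of weight `μ` in `𝕐_n(p)`. -/
def IsEnumeration {n p d : ℕ} (μ : Fin n → ℕ) (A : Fin d → Tableau n p) : Prop :=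
  (∀ k l : Fin d, k < l → A k < A l) ∧ Set.range A = {T | T.weight = μ}

/-- The matrix `U_μ`: its `(k,l)` entry is the coefficient of the leading term of `ω̃_{A_k}(p)` in
`ω̃_{A_l}(p)`. -/
def transitionMatrix {n p d : ℕ} (A : Fin d → Tableau n p) : Matrix (Fin d) (Fin d) ℂ :=
  Matrix.of fun k l => pairing (A k).leadingTerm (A l).omegaTilde

/-- The vector `f_μ(v)` of the coefficients in `v` of the leading terms. -/
def leadingCoeffs {n p d : ℕ} (A : Fin d → Tableau n p) (v : CliffPoly n p) : Fin d → ℂ :=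
  fun k => pairing (A k).leadingTerm v

open Classical in
/-- The chains `k = l_0 < l_1 < ⋯ < l_t` in an index set of size `d`. -/
def chains {d : ℕ} (k : Fin d) (t : ℕ) : Finset (Fin (t + 1) → Fin d) :=
  Finset.univ.filter fun l => l 0 = k ∧ StrictMono l

end

end Paraboson

/-!
Every `v` in `L_n(p)` is invariant under the infinitesimal rotations of `𝔰𝔬(p)` acting diagonally
on the variables and on the Clifford algebra, since these commute with all `X_i` and `D_i` and kill
`1`; moreover, the Clifford parity `η` of a monomial of `v` is determined by its exponent `γ`. If
`v ≠ 0`, the component of `v` of lexicographically largest column degree is therefore killed by the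
polarizations `∑_i x_{i,α} ∂_{i,β}` with `α < β`. The lexicographically largest monomial of a
polynomial killed by these satisfies a ballot condition, which says that its exponent comes from a
semistandard tableau. Indeed, on the monomials that differ by moving factors between the columns `α`
and `β` the polarization acts as `∑_i ∂_i`, and the lexicographically smallest exponent `b` of a
translation-invariant polynomial with partial degrees at most `d_i` satisfies
`∑_{i ≤ k} b_i ≤ ∑_{i < k} (d_i - b_i)`. So the coefficients of the leading terms `t_A` separate the
vectors of `L_n(p)`.

Conversely, `ω̃_A(p)` is `t_A` plus an integer combination of monomials with strictly smaller corner
sums, and smaller corner sums mean earlier tableaux. This makes `U_μ` unitriangular, so the vectors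
`ω̃_A(p)` form a basis, and the Neumann series of `U_μ⁻¹` expresses the coordinates as sums over
chains with integer coefficients.
-/

namespace PolynomialShift

noncomputable section

/-! ### Translation-invariant polynomials -/

section

open Polynomial

variable {W : Type*} [CommRing W]

/-- The extension of `τ : W → W[t]` to `W[y] → W[y][t]` by `y ↦ y + t`. Iterated, it builds the
simultaneous translation of several variables one variable at a time. -/
def extendShift (τ : W →+* W[X]) : W[X] →+* W[X][X] :=
  eval₂RingHom ((mapRingHom C).comp τ) (C X + X)

theorem extendShift_C (τ : W →+* W[X]) (w : W) : extendShift τ (C w) = (τ w).map C := by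
  simp [extendShift]

theorem extendShift_X (τ : W →+* W[X]) : extendShift τ X = X + C X := by
  simp [extendShift, add_comm]

theorem eval_zero_extendShift {τ : W →+* W[X]} (hτ : ∀ w, (τ w).eval 0 = w) (P : W[X]) :
    (extendShift τ P).eval 0 = P := by
  have hcomp : (evalRingHom (0 : W[X])).comp (extendShift τ) = RingHom.id _ := by
    refine ringHom_ext (fun w => ?_) ?_
    · simp [extendShift_C, hτ]
    · simp [extendShift_X]
  exact DFunLike.congr_fun hcomp P

theorem natDegree_coeff_extendShift_le (τ : W →+* W[X]) {P : W[X]} {d : ℕ}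
    (hd : P.natDegree ≤ d) (i : ℕ) : ((extendShift τ P).coeff i).natDegree ≤ d := by
  rw [P.as_sum_range' (d + 1) (Nat.lt_succ_of_le hd), map_sum, finsetSum_coeff]
  refine natDegree_sum_le_of_forall_le _ _ fun b hb => ?_
  rw [← C_mul_X_pow_eq_monomial, map_mul, map_pow, extendShift_C, extendShift_X, coeff_mul]
  refine natDegree_sum_le_of_forall_le _ _ fun x _ => ?_
  rw [coeff_map, coeff_X_add_C_pow, ← C_eq_natCast, mul_comm _ (C _)]
  have hX := natDegree_X_pow_le (R := W) (b - x.2)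
  have hb' := Finset.mem_range.mp hb
  exact (natDegree_C_mul_le _ _).trans ((natDegree_C_mul_le _ _).trans (by omega))

/-- The substitution `y ↦ -t` in `W[y][t]`. -/
def substNeg : W[X][X] →+* W[X] :=
  eval₂RingHom (compRingHom (-X)) X

theorem substNeg_extendShift (τ : W →+* W[X]) (P : W[X]) :
    substNeg (extendShift τ P) = τ (P.coeff 0) := by
  have hcomp : substNeg.comp (extendShift τ) = τ.comp constantCoeff := by
    refine ringHom_ext (fun w => ?_) ?_
    · have hC : (compRingHom (-X) : W[X] →+* W[X]).comp C = C := by ext; simp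
      simp [extendShift_C, substNeg, eval₂_map, hC]
    · simp [extendShift_X, substNeg]
  exact DFunLike.congr_fun hcomp P

theorem natDegree_substNeg_le {Z : W[X][X]} {d s : ℕ} (hs : Z.natDegree ≤ s)
    (hd : ∀ i, (Z.coeff i).natDegree ≤ d) : (substNeg Z).natDegree ≤ s + d := by
  have hcomp : ∀ i, ((Z.coeff i).comp (-X)).natDegree ≤ d := fun i => by
    have hX : (-X : W[X]).natDegree ≤ 1 := by rw [natDegree_neg]; exact natDegree_X_le
    exact natDegree_comp_le.trans ((Nat.mul_le_mul (hd i) hX).trans_eq (mul_one d))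
  rw [substNeg, coe_eval₂RingHom, eval₂_eq_sum_range]
  refine natDegree_sum_le_of_forall_le _ _ fun i hi => natDegree_mul_le.trans ?_
  have hX := natDegree_X_pow_le (R := W) i
  have hi' := Finset.mem_range.mp hi
  have hi'' := hcomp i
  rw [coe_compRingHom_apply]
  omega

-- Write `P = y ^ j * h`. The shift of `h` has degree at most `s - j` in `t` and at most
-- `natDegree h` in `y`, and the substitution `y ↦ -t` turns it into `τ (h.coeff 0)`.
theorem natDegree_shift_coeff_le [IsDomain W] {τ : W →+* W[X]} (hτ : ∀ w, (τ w).eval 0 = w)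
    {P : W[X]} {j d s : ℕ} (hd : P.natDegree ≤ d) (hj : ∀ i < j, P.coeff i = 0)
    (hne : P.coeff j ≠ 0) (hs : (extendShift τ P).natDegree ≤ s) :
    j ≤ s ∧ (τ (P.coeff j)).natDegree + 2 * j ≤ s + d := by
  obtain ⟨h, rfl⟩ := X_pow_dvd_iff.mpr hj
  have hcoeff : (X ^ j * h).coeff j = h.coeff 0 := by simp [coeff_X_pow_mul']
  rw [hcoeff] at hne ⊢
  have hh : h ≠ 0 := by rintro rfl; simp at hne
  have hshift : extendShift τ h ≠ 0 := fun h0 =>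
    hh (by rw [← eval_zero_extendShift hτ h, h0, eval_zero])
  have hdeg : (X ^ j * h).natDegree = j + h.natDegree := by
    rw [natDegree_mul (pow_ne_zero _ X_ne_zero) hh, natDegree_X_pow]
  have hdegShift : (extendShift τ (X ^ j * h)).natDegree = j + (extendShift τ h).natDegree := by
    rw [map_mul, map_pow, extendShift_X, natDegree_mul (pow_ne_zero _ (X_add_C_ne_zero _)) hshift,
      natDegree_pow, natDegree_X_add_C, mul_one]
  have key := natDegree_substNeg_le (Z := extendShift τ h) (s := s - j) (d := d - j) (by omega)
    (natDegree_coeff_extendShift_le τ (by omega))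
  rw [substNeg_extendShift] at key
  omega

/-- The simultaneous translation `y_i ↦ y_i + t` of all variables. -/
def shift (R σ : Type*) [CommRing R] : MvPolynomial σ R →+* (MvPolynomial σ R)[X] :=
  MvPolynomial.eval₂Hom (C.comp MvPolynomial.C) fun i => C (MvPolynomial.X i) + X

variable {R : Type*} [CommRing R]

theorem eval_zero_shift {σ : Type*} (v : MvPolynomial σ R) : (shift R σ v).eval 0 = v := by
  have hcomp : (evalRingHom (0 : MvPolynomial σ R)).comp (shift R σ) = RingHom.id _ := by
    refine MvPolynomial.ringHom_ext (fun w => ?_) fun i => ?_ <;> simp [shift]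
  exact DFunLike.congr_fun hcomp v

theorem extendShift_finSuccEquiv {n : ℕ} (v : MvPolynomial (Fin (n + 1)) R) :
    extendShift (shift R (Fin n)) (MvPolynomial.finSuccEquiv R n v)
      = (shift R (Fin (n + 1)) v).map (MvPolynomial.finSuccEquiv R n : _ →+* _) := by
  have hcomp : (extendShift (shift R (Fin n))).comp (MvPolynomial.finSuccEquiv R n : _ →+* _)
      = (mapRingHom (MvPolynomial.finSuccEquiv R n : _ →+* _)).comp (shift R (Fin (n + 1))) := by
    refine MvPolynomial.ringHom_ext (fun w => ?_) fun i => ?_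
    · simp [shift, MvPolynomial.finSuccEquiv_apply, extendShift_C]
    · refine Fin.cases ?_ (fun i => ?_) i
      · simp [shift, MvPolynomial.finSuccEquiv_X_zero, extendShift_X, add_comm]
      · simp [shift, MvPolynomial.finSuccEquiv_X_succ, extendShift_C]
  exact DFunLike.congr_fun hcomp v

theorem sum_Iic_succ {M : Type*} [AddCommMonoid M] {n : ℕ} (f : Fin (n + 1) → M) (k : Fin n) :
    ∑ i ∈ Finset.Iic k.succ, f i = f 0 + ∑ i ∈ Finset.Iic k, f i.succ := by
  simp [← Finset.filter_ge_eq_Iic, Finset.sum_filter, Fin.sum_univ_succ]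

theorem sum_Iio_succ {M : Type*} [AddCommMonoid M] {n : ℕ} (f : Fin (n + 1) → M) (k : Fin n) :
    ∑ i ∈ Finset.Iio k.succ, f i = f 0 + ∑ i ∈ Finset.Iio k, f i.succ := by
  simp [← Finset.filter_gt_eq_Iio, Finset.sum_filter, Fin.sum_univ_succ]

/-- `b` is the lexicographically smallest monomial of `v`, the exponent of the first variable being
compared first. -/
def IsLexLeast {n : ℕ} (v : MvPolynomial (Fin n) R) (b : Fin n →₀ ℕ) : Prop :=
  b ∈ v.support ∧ ∀ c ∈ v.support, ∀ k, (∀ i < k, c i = b i) → b k ≤ c k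

namespace IsLexLeast

variable {n : ℕ} {v : MvPolynomial (Fin (n + 1)) R} {b : Fin (n + 1) →₀ ℕ}

theorem coeff_finSuccEquiv_eq_zero (h : IsLexLeast v b) {i : ℕ} (hi : i < b 0) :
    (MvPolynomial.finSuccEquiv R n v).coeff i = 0 := by
  by_contra hne
  obtain ⟨m, hm⟩ := MvPolynomial.support_nonempty.mpr hne
  have hle := h.2 _ (MvPolynomial.mem_support_coeff_finSuccEquiv.mp hm) 0 (by simp)
  rw [Finsupp.cons_zero] at hle
  omega

theorem tail (h : IsLexLeast v b) :
    IsLexLeast ((MvPolynomial.finSuccEquiv R n v).coeff (b 0)) b.tail := by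
  refine ⟨MvPolynomial.mem_support_coeff_finSuccEquiv.mpr (by rw [Finsupp.cons_tail]; exact h.1),
    fun c hc k hk => ?_⟩
  have hle := h.2 _ (MvPolynomial.mem_support_coeff_finSuccEquiv.mp hc) k.succ fun i hi => ?_
  · rwa [Finsupp.cons_succ] at hle
  · refine Fin.cases (fun _ => Finsupp.cons_zero _ _) (fun i hi => ?_) i hi
    rw [Finsupp.cons_succ, hk i (Fin.succ_lt_succ_iff.mp hi), Finsupp.tail_apply]

end IsLexLeast

theorem sum_exponents_le [IsDomain R] {n : ℕ} {s : ℕ} {d : Fin n → ℕ} {v : MvPolynomial (Fin n) R}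
    {b : Fin n →₀ ℕ} (hs : (shift R (Fin n) v).natDegree ≤ s)
    (hd : ∀ i, v.degreeOf i ≤ d i) (hb : IsLexLeast v b) (k : Fin n) :
    ∑ i ∈ Finset.Iic k, b i ≤ s + ∑ i ∈ Finset.Iio k, (d i - b i) := by
  induction n generalizing s with
  | zero => exact k.elim0
  | succ n ih =>
    set P := MvPolynomial.finSuccEquiv R n v
    have hdegP : P.natDegree ≤ d 0 := (MvPolynomial.natDegree_finSuccEquiv v).trans_le (hd 0)
    have hshiftP : (extendShift (shift R (Fin n)) P).natDegree ≤ s := by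
      rw [extendShift_finSuccEquiv]
      exact natDegree_map_le.trans hs
    obtain ⟨hb0, hcoeff⟩ := natDegree_shift_coeff_le eval_zero_shift hdegP
      (fun i => hb.coeff_finSuccEquiv_eq_zero) (MvPolynomial.support_nonempty.mp ⟨_, hb.tail.1⟩)
      hshiftP
    have hbd := MvPolynomial.degreeOf_le_iff.mp (hd 0) b hb.1
    refine Fin.cases ?_ (fun k => ?_) k
    · simpa [← Finset.filter_ge_eq_Iic, Finset.sum_filter, ← Finset.filter_gt_eq_Iio] using hb0
    · have hrest := ih (Nat.le_sub_of_add_le hcoeff)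
        (fun i => (MvPolynomial.degreeOf_coeff_finSuccEquiv v i (b 0)).trans (hd i.succ)) hb.tail k
      simp only [Finsupp.tail_apply] at hrest
      rw [sum_Iic_succ, sum_Iio_succ]
      omega

theorem derivative_shift {σ : Type*} [Fintype σ] (v : MvPolynomial σ R) :
    derivative (shift R σ v) = shift R σ (∑ i, MvPolynomial.pderiv i v) := by
  classical
  induction v using MvPolynomial.induction_on with
  | C a => simp [shift]
  | add p q hp hq => simp only [map_add, hp, hq, Finset.sum_add_distrib]
  | mul_X p i hp =>
    have hleibniz : ∑ j, MvPolynomial.pderiv j (p * MvPolynomial.X i)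
        = (∑ j, MvPolynomial.pderiv j p) * MvPolynomial.X i + p := by
      simp [Derivation.leibniz, MvPolynomial.pderiv_X, Finset.sum_add_distrib, Pi.single_apply,
        Finset.mul_sum, mul_comm, add_comm]
    rw [hleibniz, map_mul, derivative_mul, hp, map_add, map_mul]
    simp [shift]

theorem natDegree_shift_eq_zero [IsDomain R] [CharZero R] {σ : Type*} [Fintype σ]
    {v : MvPolynomial σ R} (hv : ∑ i, MvPolynomial.pderiv i v = 0) :
    (shift R σ v).natDegree = 0 :=
  derivative_eq_zero.mp (by rw [derivative_shift, hv, map_zero])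

end

end

end PolynomialShift

namespace Paraboson

noncomputable section

/-! ### Polarizations and the ballot condition -/

section Polarization

variable {R ι κ : Type*} [CommRing R] [Fintype ι]

/-- The polarization operator `E_{αβ} = ∑_i x_{i,α} ∂_{i,β}`. -/
def polarization (α β : κ) :
    Derivation R (MvPolynomial (ι × κ) R) (MvPolynomial (ι × κ) R) :=
  ∑ i, (MvPolynomial.X (i, α) : MvPolynomial (ι × κ) R) • MvPolynomial.pderiv (i, β)

theorem polarization_apply (α β : κ) (f : MvPolynomial (ι × κ) R) :
    polarization α β f = ∑ i, MvPolynomial.X (i, α) * MvPolynomial.pderiv (i, β) f := by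
  change Derivation.coeFnAddMonoidHom (polarization α β) f = _
  simp [polarization, map_sum]

theorem coeff_polarization {α β : κ} (h : α ≠ β) (f : MvPolynomial (ι × κ) R)
    (m : ι × κ →₀ ℕ) :
    (polarization α β f).coeff m = ∑ i, if m (i, α) = 0 then 0 else
      f.coeff (m - Finsupp.single (i, α) 1 + Finsupp.single (i, β) 1) * (m (i, β) + 1) := by
  classical
  simp [polarization_apply, MvPolynomial.coeff_sum, MvPolynomial.coeff_X_mul',
    MvPolynomial.coeff_pderiv, h]

variable [Finite κ] [DecidableEq κ]

/-- The exponent which differs from `γ` only in the columns `α` and `β`: the factors `x_{i,α}` and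
`x_{i,β}` are redistributed within each row so that `b i` of them are `x_{i,β}`. It is meaningful
if `b i ≤ γ (i, α) + γ (i, β)`, as the subtraction is truncated. -/
def redistribute (γ : ι × κ →₀ ℕ) (α β : κ) (b : ι →₀ ℕ) : ι × κ →₀ ℕ :=
  Finsupp.equivFunOnFinite.symm fun x =>
    if x.2 = α then γ (x.1, α) + γ (x.1, β) - b x.1 else if x.2 = β then b x.1 else γ x

theorem redistribute_left (γ : ι × κ →₀ ℕ) (α β : κ) (b : ι →₀ ℕ) (i : ι) :
    redistribute γ α β b (i, α) = γ (i, α) + γ (i, β) - b i := by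
  simp [redistribute]

theorem redistribute_right (γ : ι × κ →₀ ℕ) {α β : κ} (h : α ≠ β) (b : ι →₀ ℕ) (i : ι) :
    redistribute γ α β b (i, β) = b i := by
  simp [redistribute, h.symm]

theorem redistribute_of_ne (γ : ι × κ →₀ ℕ) {α β κ' : κ} (hα : κ' ≠ α) (hβ : κ' ≠ β)
    (b : ι →₀ ℕ) (i : ι) : redistribute γ α β b (i, κ') = γ (i, κ') := by
  simp [redistribute, hα, hβ]

theorem redistribute_eq_self_of_eq (γ : ι × κ →₀ ℕ) (α β : κ) {b : ι →₀ ℕ} {i : ι}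
    (h : b i = γ (i, β)) (κ' : κ) : redistribute γ α β b (i, κ') = γ (i, κ') := by
  rcases eq_or_ne κ' α with rfl | hα
  · rw [redistribute_left, h, Nat.add_sub_cancel]
  · rcases eq_or_ne κ' β with rfl | hβ
    · rw [redistribute_right γ hα.symm, h]
    · exact redistribute_of_ne γ hα hβ b i

theorem redistribute_add_single (γ : ι × κ →₀ ℕ) {α β : κ} (h : α ≠ β) {b : ι →₀ ℕ} {i : ι}
    (hi : b i < γ (i, α) + γ (i, β)) :
    redistribute γ α β (b + Finsupp.single i 1)
      = redistribute γ α β b - Finsupp.single (i, α) 1 + Finsupp.single (i, β) 1 := by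
  classical
  ext ⟨j, κ'⟩
  rw [Finsupp.add_apply, Finsupp.tsub_apply, Finsupp.single_apply, Finsupp.single_apply]
  rcases eq_or_ne κ' α with rfl | hα
  · rw [redistribute_left, redistribute_left, Finsupp.add_apply, Finsupp.single_apply]
    rcases eq_or_ne i j with rfl | hj
    · rw [if_pos rfl, if_pos rfl, if_neg (by simp [h.symm])]
      omega
    · simp [hj]
  · rcases eq_or_ne κ' β with rfl | hβ
    · simp [redistribute_right γ h, Finsupp.single_apply, h]
    · simp [redistribute_of_ne γ hα hβ, hα.symm, hβ.symm]

variable [DecidableEq ι]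

/-- The part of `f` formed by the monomials that agree with `γ` up to redistribution of the columns
`α` and `β`, written as a polynomial in variables `y_i` that record the exponents of the `x_{i,β}`.
On such slices `E_{αβ}` becomes `∑_i ∂_i`. -/
def redistributionSlice (f : MvPolynomial (ι × κ) R) (γ : ι × κ →₀ ℕ) (α β : κ) :
    MvPolynomial ι R :=
  ∑ b ∈ Finset.Iic (Finsupp.equivFunOnFinite.symm fun i => γ (i, α) + γ (i, β)),
    MvPolynomial.monomial b (f.coeff (redistribute γ α β b))

theorem coeff_redistributionSlice (f : MvPolynomial (ι × κ) R) (γ : ι × κ →₀ ℕ) (α β : κ)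
    (b : ι →₀ ℕ) : (redistributionSlice f γ α β).coeff b =
      if ∀ i, b i ≤ γ (i, α) + γ (i, β) then f.coeff (redistribute γ α β b) else 0 := by
  simp [redistributionSlice, MvPolynomial.coeff_sum, MvPolynomial.coeff_monomial,
    Finsupp.le_def]

theorem mem_support_redistributionSlice {f : MvPolynomial (ι × κ) R} {γ : ι × κ →₀ ℕ} {α β : κ}
    {b : ι →₀ ℕ} : b ∈ (redistributionSlice f γ α β).support ↔
      (∀ i, b i ≤ γ (i, α) + γ (i, β)) ∧ redistribute γ α β b ∈ f.support := by
  simp only [MvPolynomial.mem_support_iff, coeff_redistributionSlice, ite_ne_right_iff]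

theorem sum_pderiv_redistributionSlice {f : MvPolynomial (ι × κ) R} {α β : κ} (h : α ≠ β)
    (hf : polarization α β f = 0) (γ : ι × κ →₀ ℕ) :
    ∑ i, MvPolynomial.pderiv i (redistributionSlice f γ α β) = 0 := by
  ext b
  simp only [MvPolynomial.coeff_sum, MvPolynomial.coeff_zero, MvPolynomial.coeff_pderiv,
    coeff_redistributionSlice]
  by_cases hb : ∀ i, b i ≤ γ (i, α) + γ (i, β)
  · have hcoeff := coeff_polarization h f (redistribute γ α β b)
    rw [hf, MvPolynomial.coeff_zero] at hcoeff
    refine Eq.trans (Finset.sum_congr rfl fun i _ => ?_) hcoeff.symm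
    rw [redistribute_left, redistribute_right γ h]
    rcases (hb i).lt_or_eq with hi | hi
    · have hle : ∀ j, (b + Finsupp.single i 1 : ι →₀ ℕ) j ≤ γ (j, α) + γ (j, β) := fun j => by
        rcases eq_or_ne j i with rfl | hj
        · simpa using hi
        · simpa [Finsupp.single_apply, hj.symm] using hb j
      rw [if_pos hle, if_neg (by omega), redistribute_add_single γ h hi]
    · have hnle : ¬ ∀ j, (b + Finsupp.single i 1 : ι →₀ ℕ) j ≤ γ (j, α) + γ (j, β) := fun hle => by
        simpa [hi] using hle i
      rw [if_neg hnle, if_pos (by omega), zero_mul]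
  · refine Finset.sum_eq_zero fun i _ => ?_
    rw [if_neg fun hle => hb fun j => le_trans (by simp) (hle j), zero_mul]

end Polarization

section Ballot

variable {R κ : Type*} [CommRing R] [LinearOrder κ] [Finite κ] {n : ℕ}

/-- The rows of the exponent matrix `γ`, for comparing exponents lexicographically. -/
def rowReading (γ : Fin n × κ →₀ ℕ) : Lex (Fin n → Lex (κ → ℕ)) :=
  toLex fun i => toLex fun α => γ (i, α)

/-- The ballot condition on `γ`. If `γ (i, α)` is the number of entries `i` in the row `α` of a
filling whose rows are weakly increasing, it says that the columns are strictly increasing. -/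
def IsBallot (γ : Fin n × κ →₀ ℕ) : Prop :=
  ∀ ⦃α β : κ⦄, α < β → ∀ k, ∑ i ∈ Finset.Iic k, γ (i, β) ≤ ∑ i ∈ Finset.Iio k, γ (i, α)

theorem rowReading_lt_redistribute (γ : Fin n × κ →₀ ℕ) {α β : κ} (h : α < β) {b : Fin n →₀ ℕ}
    {k : Fin n} (hlt : ∀ i < k, b i = γ (i, β)) (hk : b k < γ (k, β)) :
    rowReading γ < rowReading (redistribute γ α β b) := by
  refine ⟨k, fun i hi => congrArg toLex (funext fun κ' =>
    (redistribute_eq_self_of_eq γ α β (hlt i hi) κ').symm), α, fun κ' hκ' => ?_, ?_⟩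
  · exact (redistribute_of_ne γ hκ'.ne (hκ'.trans h).ne b k).symm
  · change γ (k, α) < redistribute γ α β b (k, α)
    rw [redistribute_left]
    omega

theorem isLexLeast_redistributionSlice {f : MvPolynomial (Fin n × κ) R} {γ : Fin n × κ →₀ ℕ}
    (hγ : γ ∈ f.support) (hmax : ∀ δ ∈ f.support, rowReading δ ≤ rowReading γ) {α β : κ}
    (h : α < β) : PolynomialShift.IsLexLeast (redistributionSlice f γ α β)
      (Finsupp.equivFunOnFinite.symm fun i => γ (i, β)) := by
  refine ⟨mem_support_redistributionSlice.mpr ⟨by simp, ?_⟩, fun b hb k hlt => ?_⟩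
  · have hself : redistribute γ α β (Finsupp.equivFunOnFinite.symm fun i => γ (i, β)) = γ :=
      Finsupp.ext fun x => redistribute_eq_self_of_eq γ α β rfl x.2
    rwa [hself]
  · by_contra! hk
    exact (rowReading_lt_redistribute γ h hlt hk).not_ge
      (hmax _ (mem_support_redistributionSlice.mp hb).2)

theorem isBallot_of_polarization_eq_zero [IsDomain R] [CharZero R]
    {f : MvPolynomial (Fin n × κ) R} (hf : ∀ α β : κ, α < β → polarization α β f = 0)
    {γ : Fin n × κ →₀ ℕ} (hγ : γ ∈ f.support)
    (hmax : ∀ δ ∈ f.support, rowReading δ ≤ rowReading γ) : IsBallot γ := by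
  intro α β h k
  have hdeg : ∀ i, (redistributionSlice f γ α β).degreeOf i ≤ γ (i, α) + γ (i, β) := fun i =>
    MvPolynomial.degreeOf_le_iff.mpr fun b hb => (mem_support_redistributionSlice.mp hb).1 i
  simpa using PolynomialShift.sum_exponents_le
    (PolynomialShift.natDegree_shift_eq_zero
      (sum_pderiv_redistributionSlice h.ne (hf α β h) γ)).le
    hdeg (isLexLeast_redistributionSlice hγ hmax h) k

end Ballot

/-! ### Inversion of unitriangular matrices -/

section Chains

variable {d : ℕ}

theorem mem_chains {k : Fin d} {t : ℕ} {l : Fin (t + 1) → Fin d} :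
    l ∈ chains k t ↔ l 0 = k ∧ StrictMono l := by
  simp [chains]

theorem chains_eq_empty {k : Fin d} {t : ℕ} (h : d ≤ t + k) : chains k t = ∅ := by
  refine Finset.eq_empty_of_forall_notMem fun l hl => ?_
  obtain ⟨rfl, hmono⟩ := mem_chains.mp hl
  have hgrowth : ∀ s : Fin (t + 1), (l 0 : ℕ) + s ≤ l s := fun s => by
    induction s using Fin.induction with
    | zero => exact le_rfl
    | succ s ih =>
      have hstep := Fin.lt_def.mp (hmono s.castSucc_lt_succ)
      simp only [Fin.val_succ, Fin.val_castSucc] at ih hstep ⊢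
      omega
  have hlast := hgrowth (Fin.last t)
  rw [Fin.val_last] at hlast
  omega

theorem chains_zero (k : Fin d) : chains k 0 = {fun _ => k} := by
  ext l
  rw [mem_chains, Finset.mem_singleton]
  refine ⟨fun h => funext fun i => by rw [Fin.fin_one_eq_zero i, h.1], ?_⟩
  rintro rfl
  exact ⟨rfl, fun i j hij => absurd hij (by simp [Fin.fin_one_eq_zero])⟩

theorem cons_mem_chains {k j : Fin d} (hkj : k < j) {t : ℕ} {l : Fin (t + 1) → Fin d}
    (hl : l ∈ chains j t) : (Fin.cons k l : Fin (t + 2) → Fin d) ∈ chains k (t + 1) := by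
  obtain ⟨rfl, hmono⟩ := mem_chains.mp hl
  exact mem_chains.mpr ⟨rfl, strictMono_vecCons.mpr ⟨hkj, hmono⟩⟩

theorem sum_chains_succ {M : Type*} [AddCommMonoid M] (k : Fin d) (t : ℕ)
    (F : (Fin (t + 2) → Fin d) → M) :
    ∑ l ∈ chains k (t + 1), F l
      = ∑ j ∈ Finset.Ioi k, ∑ l ∈ chains j t, F (Fin.cons k l : Fin (t + 2) → Fin d) := by
  rw [Finset.sum_sigma']
  refine Finset.sum_bij' (fun l _ => ⟨l 1, Fin.tail l⟩) (fun x _ => Fin.cons k x.2) ?_ ?_ ?_ ?_ ?_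
  · intro l hl
    obtain ⟨rfl, hmono⟩ := mem_chains.mp hl
    rw [Finset.mem_sigma, Finset.mem_Ioi, mem_chains]
    exact ⟨hmono (by simp), rfl, hmono.comp Fin.strictMono_succ⟩
  · rintro ⟨j, l⟩ hx
    rw [Finset.mem_sigma, Finset.mem_Ioi] at hx
    exact cons_mem_chains hx.1 hx.2
  · intro l hl
    rw [← (mem_chains.mp hl).1]
    exact Fin.cons_self_tail l
  · rintro ⟨j, l⟩ hx
    have hl : l 0 = j := (mem_chains.mp (Finset.mem_sigma.mp hx).2).1
    simp [hl]
  · intro l hl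
    rw [← (mem_chains.mp hl).1]
    exact congrArg F (Fin.cons_self_tail l).symm

end Chains

section Unitriangular

variable {R : Type*} [CommRing R] {d : ℕ}

/-- Upper triangular matrices with ones on the diagonal. -/
structure IsUnitriangular (U : Matrix (Fin d) (Fin d) R) : Prop where
  upper : U.IsUpperTriangular
  diag : ∀ k, U k k = 1

theorem IsUnitriangular.det_eq_one {U : Matrix (Fin d) (Fin d) R} (hU : IsUnitriangular U) :
    U.det = 1 := by
  simp [Matrix.det_of_isUpperTriangular hU.upper, hU.diag]

theorem IsUnitriangular.mulVec_apply {U : Matrix (Fin d) (Fin d) R} (hU : IsUnitriangular U)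
    (g : Fin d → R) (k : Fin d) : U.mulVec g k = g k + ∑ j ∈ Finset.Ioi k, U k j * g j := by
  have hsub : ∑ j ∈ Finset.Ici k, U k j * g j = ∑ j, U k j * g j :=
    Finset.sum_subset (Finset.subset_univ _) fun j _ hj => by
      rw [hU.upper (not_le.mp (Finset.mem_Ici.not.mp hj)), zero_mul]
  rw [Matrix.mulVec, dotProduct, ← hsub, ← Finset.Ioi_insert, Finset.sum_insert (by simp),
    hU.diag, one_mul]

/-- The contribution of the chains with `t` steps to the coordinate `(U⁻¹ f)_k`. -/
def chainTerm (U : Matrix (Fin d) (Fin d) R) (f : Fin d → R) (t : ℕ) (k : Fin d) : R :=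
  ∑ l ∈ chains k t, (-1) ^ t * (∏ s : Fin t, U (l s.castSucc) (l s.succ)) * f (l (Fin.last t))

/-- The coordinates `(U⁻¹ f)_k` as sums over chains: the Neumann series of `U⁻¹ = (1 + N)⁻¹`. -/
def chainSum (U : Matrix (Fin d) (Fin d) R) (f : Fin d → R) (k : Fin d) : R :=
  ∑ t ∈ Finset.range (d - (k : ℕ)), chainTerm U f t k

theorem chainTerm_zero (U : Matrix (Fin d) (Fin d) R) (f : Fin d → R) (k : Fin d) :
    chainTerm U f 0 k = f k := by
  simp [chainTerm, chains_zero]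

theorem chainTerm_succ (U : Matrix (Fin d) (Fin d) R) (f : Fin d → R) (t : ℕ) (k : Fin d) :
    chainTerm U f (t + 1) k = -∑ j ∈ Finset.Ioi k, U k j * chainTerm U f t j := by
  simp only [chainTerm, sum_chains_succ, Finset.mul_sum, ← Finset.sum_neg_distrib]
  refine Finset.sum_congr rfl fun j _ => Finset.sum_congr rfl fun l hl => ?_
  obtain ⟨rfl, -⟩ := mem_chains.mp hl
  rw [Fin.prod_univ_succ, ← Fin.succ_last, Fin.cons_succ, Fin.castSucc_zero, Fin.cons_zero,
    Fin.cons_succ, pow_succ]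
  simp only [← Fin.succ_castSucc, Fin.cons_succ]
  ring

theorem chainSum_eq_sum_range (U : Matrix (Fin d) (Fin d) R) (f : Fin d → R) (k : Fin d) {m : ℕ}
    (hm : d ≤ m) : chainSum U f k = ∑ t ∈ Finset.range m, chainTerm U f t k := by
  refine Finset.sum_subset (Finset.range_mono (by omega)) fun t _ ht => ?_
  rw [Finset.mem_range, not_lt] at ht
  rw [chainTerm, chains_eq_empty (by omega), Finset.sum_empty]

theorem IsUnitriangular.mulVec_chainSum {U : Matrix (Fin d) (Fin d) R} (hU : IsUnitriangular U)
    (f : Fin d → R) : U.mulVec (chainSum U f) = f := by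
  funext k
  have hrec : chainSum U f k = f k - ∑ j ∈ Finset.Ioi k, U k j * chainSum U f j := by
    simp only [chainSum_eq_sum_range U f _ le_rfl, Finset.mul_sum]
    rw [← chainSum_eq_sum_range U f k le_rfl, chainSum_eq_sum_range U f k d.le_succ,
      Finset.sum_range_succ', chainTerm_zero, Finset.sum_comm, sub_eq_neg_add]
    simp only [chainTerm_succ, Finset.sum_neg_distrib]
  rw [hU.mulVec_apply, hrec, sub_add_cancel]

theorem chainSum_mem (S : Subring R) {U : Matrix (Fin d) (Fin d) R} {f : Fin d → R}
    (hU : ∀ k l, U k l ∈ S) (hf : ∀ k, f k ∈ S) (k : Fin d) : chainSum U f k ∈ S :=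
  sum_mem fun _ _ => sum_mem fun _ _ =>
    mul_mem (mul_mem (pow_mem (neg_mem (one_mem S)) _) (prod_mem fun _ _ => hU _ _)) (hf _)

end Unitriangular

/-! ### Products of anticommuting elements -/

section Anticommuting

variable {R : Type*} [Ring R]

theorem prod_ofFn_swap_succ {k : ℕ} {y : Fin (k + 1) → R}
    (hy : Pairwise fun a b => y a * y b = -(y b * y a)) (i : Fin k) :
    (List.ofFn fun r => y (Equiv.swap i.castSucc i.succ r)).prod = -(List.ofFn y).prod := by
  induction k with
  | zero => exact i.elim0
  | succ k ih =>
    rw [List.ofFn_succ, List.ofFn_succ (f := y), List.prod_cons, List.prod_cons]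
    induction i using Fin.cases with
    | zero =>
      have htail : ∀ r : Fin k, Equiv.swap (Fin.castSucc 0) (Fin.succ 0) r.succ.succ
          = (r.succ.succ : Fin (k + 2)) := fun r =>
        Equiv.swap_apply_of_ne_of_ne (by simp) (by simp [Fin.ext_iff])
      simp only [List.ofFn_succ, List.prod_cons, htail, Equiv.swap_apply_right, ← mul_assoc,
        ← neg_mul, show (0 : Fin (k + 2)) = Fin.castSucc 0 from rfl, Equiv.swap_apply_left]
      rw [hy (Fin.castSucc_lt_succ).ne', neg_mul_eq_neg_mul]
    | succ i =>
      have hhead : Equiv.swap i.succ.castSucc i.succ.succ 0 = 0 :=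
        Equiv.swap_apply_of_ne_of_ne (by simp [Fin.ext_iff]) (Fin.succ_ne_zero _).symm
      have htail : ∀ r : Fin (k + 1), Equiv.swap i.succ.castSucc i.succ.succ r.succ
          = (Equiv.swap i.castSucc i.succ r).succ := fun r => by
        rw [← Fin.succ_castSucc]
        exact (Fin.succ_injective _).swap_apply _ _ _
      simp only [hhead, htail]
      rw [ih (hy.comp_of_injective (Fin.succ_injective _)) i, mul_neg]

theorem prod_ofFn_perm {k : ℕ} {y : Fin k → R}
    (hy : Pairwise fun a b => y a * y b = -(y b * y a)) (σ : Equiv.Perm (Fin k)) :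
    (List.ofFn fun r => y (σ r)).prod = Equiv.Perm.sign σ • (List.ofFn y).prod := by
  cases k with
  | zero => simp [Subsingleton.elim σ 1]
  | succ k =>
    have hσ : σ ∈ Submonoid.closure
        (Set.range fun i : Fin k => Equiv.swap i.castSucc i.succ) := by
      rw [Equiv.Perm.mclosure_swap_castSucc_succ]
      trivial
    induction hσ using Submonoid.closure_induction_right with
    | one => simp
    | mul_right σ _ τ hτ ih =>
      obtain ⟨i, rfl⟩ := hτ
      simp only [Equiv.Perm.mul_apply]
      rw [prod_ofFn_swap_succ (hy.comp_of_injective σ.injective) i, ih, Equiv.Perm.sign_mul,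
        Equiv.Perm.sign_swap (Fin.castSucc_lt_succ).ne, mul_neg_one, Units.neg_smul]

theorem sum_sign_smul_prod_of_injective {ι : Type*} {y : ι → R}
    (hy : Pairwise fun a b => y a * y b = -(y b * y a)) {k : ℕ} {C : Fin k → ι}
    (hC : Function.Injective C) :
    ∑ σ : Equiv.Perm (Fin k), Equiv.Perm.sign σ • (List.ofFn fun r => y (C (σ r))).prod
      = k.factorial • (List.ofFn fun r => y (C r)).prod := by
  simp only [prod_ofFn_perm (y := fun r => y (C r)) (hy.comp_of_injective hC), smul_smul,
    Int.units_mul_self, one_smul, Finset.sum_const, Finset.card_univ, Fintype.card_perm,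
    Fintype.card_fin]

theorem sum_sign_smul_prod_of_not_injective {ι : Type*} (y : ι → R) {k : ℕ} {C : Fin k → ι}
    (hC : ¬Function.Injective C) :
    ∑ σ : Equiv.Perm (Fin k), Equiv.Perm.sign σ • (List.ofFn fun r => y (C (σ r))).prod = 0 := by
  simp only [Function.Injective, not_forall] at hC
  obtain ⟨a, b, hab, hne⟩ := hC
  refine Finset.sum_involution (fun σ _ => Equiv.swap a b * σ) (fun σ _ => ?_) (fun σ _ _ h => ?_)
    (fun _ _ => Finset.mem_univ _) (fun σ _ => by simp)
  · have hswap : ∀ r, C ((Equiv.swap a b * σ) r) = C (σ r) := fun r => by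
      rw [Equiv.Perm.mul_apply, Equiv.swap_apply_def]
      split_ifs with h1 h2
      · rw [h1, hab]
      · rw [h2, hab]
      · rfl
    simp only [hswap]
    rw [Equiv.Perm.sign_mul, Equiv.Perm.sign_swap hne, neg_one_mul, Units.neg_smul, add_neg_cancel]
  · exact hne (Equiv.swap_eq_one_iff.mp (mul_eq_right.mp h))

end Anticommuting

/-! ### Coordinates with respect to the monomial basis -/

section Coordinates

variable {n p : ℕ}

/-- The index set of the monomials `x^γ e^η`. -/
abbrev MonomialIndex (n p : ℕ) : Type := (Fin n × Fin p →₀ ℕ) × (Fin p → ZMod 2)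

theorem monomialBasis_eq_tmul (b : MonomialIndex n p) :
    monomialBasis n p b = MvPolynomial.monomial b.1 1 ⊗ₜ[ℂ] cliffordBasis p b.2 := by
  rw [monomialBasis, Module.Basis.tensorProduct_apply', MvPolynomial.coe_basisMonomials]

theorem monomialBasis_repr_tmul (f : MvPolynomial (Fin n × Fin p) ℂ) (u : Cl p)
    (γ : Fin n × Fin p →₀ ℕ) (η : Fin p → ZMod 2) :
    (monomialBasis n p).repr (f ⊗ₜ u) (γ, η) = f.coeff γ * (cliffordBasis p).repr u η := by
  rw [monomialBasis, Module.Basis.tensorProduct_repr_tmul_apply, smul_eq_mul, mul_comm]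
  rfl

theorem vac_eq_monomialBasis : vac n p = monomialBasis n p (0, 0) := by
  rw [monomialBasis_eq_tmul, vac, cliffordBasis_apply, cliffordMonomial]
  simp

/-- The span of the monomials with index in `S`. -/
def supportedOn (S : Set (MonomialIndex n p)) : Submodule ℂ (CliffPoly n p) :=
  Submodule.span ℂ (monomialBasis n p '' S)

theorem mem_supportedOn {S : Set (MonomialIndex n p)} {v : CliffPoly n p} :
    v ∈ supportedOn S ↔ ∀ b, (monomialBasis n p).repr v b ≠ 0 → b ∈ S := by
  simp only [supportedOn, Module.Basis.mem_span_image, Set.subset_def, Finset.mem_coe,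
    Finsupp.mem_support_iff]

theorem supportedOn_mono {S S' : Set (MonomialIndex n p)} (h : S ⊆ S') :
    (supportedOn S : Submodule ℂ (CliffPoly n p)) ≤ supportedOn S' :=
  Submodule.span_mono (Set.image_mono h)

theorem monomialBasis_mem_supportedOn {S : Set (MonomialIndex n p)} {b : MonomialIndex n p}
    (h : b ∈ S) : monomialBasis n p b ∈ supportedOn S :=
  Submodule.subset_span (Set.mem_image_of_mem _ h)

theorem map_mem_supportedOn {S S' : Set (MonomialIndex n p)} (Φ : Module.End ℂ (CliffPoly n p))
    (h : ∀ b ∈ S, Φ (monomialBasis n p b) ∈ supportedOn S') {v : CliffPoly n p}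
    (hv : v ∈ supportedOn S) : Φ v ∈ supportedOn S' :=
  (Submodule.map_span_le Φ _ _).mpr (Set.forall_mem_image.mpr h) (Submodule.mem_map_of_mem hv)

/-- The vectors with integer coordinates. -/
def integralVectors (n p : ℕ) : Submodule ℤ (CliffPoly n p) :=
  Submodule.span ℤ (Set.range (monomialBasis n p))

theorem mem_integralVectors {v : CliffPoly n p} :
    v ∈ integralVectors n p ↔ ∀ b, ∃ z : ℤ, (monomialBasis n p).repr v b = z := by
  simp only [integralVectors, Module.Basis.mem_span_iff_repr_mem, Set.mem_range, eq_comm,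
    algebraMap_int_eq, eq_intCast]

theorem monomialBasis_mem_integralVectors (b : MonomialIndex n p) :
    monomialBasis n p b ∈ integralVectors n p :=
  Submodule.subset_span (Set.mem_range_self b)

theorem map_mem_integralVectors (Φ : Module.End ℂ (CliffPoly n p))
    (h : ∀ b, Φ (monomialBasis n p b) ∈ integralVectors n p) {v : CliffPoly n p}
    (hv : v ∈ integralVectors n p) : Φ v ∈ integralVectors n p :=
  (Submodule.map_span_le (Φ.restrictScalars ℤ) _ _).mpr (Set.forall_mem_range.mpr h)
    (Submodule.mem_map_of_mem hv)

end Coordinates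

/-! ### The generators on monomials -/

section Generators

variable {n p : ℕ}

theorem e_mul_self (α : Fin p) : (e α : Cl p) * e α = 1 := by
  have h : (2 : ℂ) • (e α * e α : Cl p) = (2 : ℂ) • 1 := by
    rw [two_smul, e_anticomm, if_pos rfl, two_smul, one_add_one_eq_two]
  exact smul_right_injective _ (two_ne_zero (α := ℂ)) h

theorem e_mul_e_of_ne {α β : Fin p} (h : α ≠ β) : (e α * e β : Cl p) = -(e β * e α) :=
  eq_neg_of_add_eq_zero_left ((e_anticomm α β).trans (if_neg h))

theorem cliffordBasis_repr_apply (u : Cl p) (η : Fin p → ZMod 2) :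
    (cliffordBasis p).repr u η = cliffordCoord p u η := by
  have : (Finsupp.lcoeFun.comp (cliffordBasis p).repr.toLinearMap : Cl p →ₗ[ℂ] _)
      = cliffordCoord p := by
    refine (cliffordBasis p).ext fun ζ => ?_
    rw [cliffordBasis_apply, cliffordCoord_monomial, ← cliffordBasis_apply]
    ext ξ
    simp [Finsupp.single_apply, Pi.single_apply, eq_comm]
  exact congrFun (DFunLike.congr_fun this u) η

theorem cliffordBasis_repr_e_mul (α : Fin p) (u : Cl p) (η : Fin p → ZMod 2) :
    (cliffordBasis p).repr (e α * u) η
      = (∏ β : Fin p, if β < α then (-1 : ℂ) ^ (η β).val else 1)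
        * (cliffordBasis p).repr u (η + Pi.single α 1) := by
  have : cliffordCoord p (e α * u) = coordMul α (cliffordCoord p u) := by
    simp [cliffordCoord, e, coordLin]
  rw [cliffordBasis_repr_apply, cliffordBasis_repr_apply, ← coordMul_apply, this]

theorem exists_units_smul_eq_e_mul (α : Fin p) (η : Fin p → ZMod 2) :
    ∃ z : ℤˣ, e α * cliffordBasis p η = (z : ℤ) • cliffordBasis p (η + Pi.single α 1) := by
  obtain ⟨z, hz⟩ : ∃ z : ℤˣ, (∏ β : Fin p, if β < α then
      (-1 : ℂ) ^ ((η + Pi.single α 1 : Fin p → ZMod 2) β).val else 1) = (z : ℤ) := by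
    refine ⟨∏ β : Fin p, if β < α then
      (-1) ^ ((η + Pi.single α 1 : Fin p → ZMod 2) β).val else 1, ?_⟩
    push_cast [apply_ite]
    rfl
  refine ⟨z, (cliffordBasis p).ext_elem fun ζ => ?_⟩
  rw [cliffordBasis_repr_e_mul, ← Int.cast_smul_eq_zsmul ℂ, ← hz, map_smul, Module.Basis.repr_self,
    Module.Basis.repr_self, Finsupp.smul_apply, smul_eq_mul]
  rcases eq_or_ne ζ (η + Pi.single α 1) with rfl | h
  · rw [shift_shift, Finsupp.single_eq_same, Finsupp.single_eq_same]
  · have h' : ζ + Pi.single α 1 ≠ η := by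
      rintro rfl
      exact h (shift_shift α ζ).symm
    rw [Finsupp.single_eq_of_ne h, Finsupp.single_eq_of_ne h', mul_zero, mul_zero]

/-- Multiplication by `x_{i,α} e_α`, the summand of index `α` of `X i`. -/
def mulXE (i : Fin n) (α : Fin p) : Module.End ℂ (CliffPoly n p) :=
  TensorProduct.map
    (LinearMap.mulLeft ℂ (MvPolynomial.X (i, α) : MvPolynomial (Fin n × Fin p) ℂ))
    (LinearMap.mulLeft ℂ (e α))

/-- The operator `∂_{i,α} e_α`, the summand of index `α` of `D i`. -/
def pderivE (i : Fin n) (α : Fin p) : Module.End ℂ (CliffPoly n p) :=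
  TensorProduct.map
    ((MvPolynomial.pderiv (i, α) :
      Derivation ℂ (MvPolynomial (Fin n × Fin p) ℂ) (MvPolynomial (Fin n × Fin p) ℂ)) :
        MvPolynomial (Fin n × Fin p) ℂ →ₗ[ℂ] MvPolynomial (Fin n × Fin p) ℂ)
    (LinearMap.mulLeft ℂ (e α))

theorem X_eq_sum (i : Fin n) : (X i : Module.End ℂ (CliffPoly n p)) = ∑ α, mulXE i α := rfl

theorem D_eq_sum (i : Fin n) : (D i : Module.End ℂ (CliffPoly n p)) = ∑ α, pderivE i α := rfl

theorem mulXE_monomialBasis (i : Fin n) (α : Fin p) (b : MonomialIndex n p) :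
    ∃ z : ℤˣ, mulXE i α (monomialBasis n p b) = (z : ℤ) • monomialBasis n p
      (b.1 + Finsupp.single (i, α) 1, b.2 + Pi.single α 1) := by
  obtain ⟨z, hz⟩ := exists_units_smul_eq_e_mul α b.2
  refine ⟨z, ?_⟩
  rw [monomialBasis_eq_tmul, monomialBasis_eq_tmul, mulXE, TensorProduct.map_tmul,
    LinearMap.mulLeft_apply, LinearMap.mulLeft_apply, hz, TensorProduct.tmul_smul, MvPolynomial.X,
    MvPolynomial.monomial_mul, one_mul, add_comm]

theorem pderivE_monomialBasis (i : Fin n) (α : Fin p) (b : MonomialIndex n p) :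
    ∃ z : ℤˣ, pderivE i α (monomialBasis n p b) = (z * b.1 (i, α) : ℤ) • monomialBasis n p
      (b.1 - Finsupp.single (i, α) 1, b.2 + Pi.single α 1) := by
  obtain ⟨z, hz⟩ := exists_units_smul_eq_e_mul α b.2
  refine ⟨z, ?_⟩
  rw [monomialBasis_eq_tmul, monomialBasis_eq_tmul, pderivE, TensorProduct.map_tmul,
    LinearMap.mulLeft_apply, hz, TensorProduct.tmul_smul, Derivation.coeFn_coe,
    MvPolynomial.pderiv_monomial, one_mul, ← (nsmul_one (b.1 (i, α)) : _ = (_ : ℂ)),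
    ← MvPolynomial.smul_monomial, ← TensorProduct.smul_tmul', mul_smul, natCast_zsmul]

theorem X_mem_integralVectors (i : Fin n) {v : CliffPoly n p} (hv : v ∈ integralVectors n p) :
    X i v ∈ integralVectors n p := by
  refine map_mem_integralVectors _ (fun b => ?_) hv
  rw [X_eq_sum, LinearMap.sum_apply]
  refine Submodule.sum_mem _ fun α _ => ?_
  obtain ⟨z, hz⟩ := mulXE_monomialBasis i α b
  exact hz ▸ Submodule.smul_mem _ _ (monomialBasis_mem_integralVectors _)

theorem D_mem_integralVectors (i : Fin n) {v : CliffPoly n p} (hv : v ∈ integralVectors n p) :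
    D i v ∈ integralVectors n p := by
  refine map_mem_integralVectors _ (fun b => ?_) hv
  rw [D_eq_sum, LinearMap.sum_apply]
  refine Submodule.sum_mem _ fun α _ => ?_
  obtain ⟨z, hz⟩ := pderivE_monomialBasis i α b
  exact hz ▸ Submodule.smul_mem _ _ (monomialBasis_mem_integralVectors _)

theorem X_mem_supportedOn {S S' : Set (MonomialIndex n p)} (i : Fin n)
    (h : ∀ b ∈ S, ∀ α, (b.1 + Finsupp.single (i, α) 1, b.2 + Pi.single α 1) ∈ S')
    {v : CliffPoly n p} (hv : v ∈ supportedOn S) : X i v ∈ supportedOn S' := by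
  refine map_mem_supportedOn _ (fun b hb => ?_) hv
  rw [X_eq_sum, LinearMap.sum_apply]
  refine Submodule.sum_mem _ fun α _ => ?_
  obtain ⟨z, hz⟩ := mulXE_monomialBasis i α b
  exact hz ▸ zsmul_mem (monomialBasis_mem_supportedOn (h b hb α)) _

theorem D_mem_supportedOn {S S' : Set (MonomialIndex n p)} (i : Fin n)
    (h : ∀ b ∈ S, ∀ α, b.1 (i, α) ≠ 0 →
      (b.1 - Finsupp.single (i, α) 1, b.2 + Pi.single α 1) ∈ S')
    {v : CliffPoly n p} (hv : v ∈ supportedOn S) : D i v ∈ supportedOn S' := by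
  refine map_mem_supportedOn _ (fun b hb => ?_) hv
  rw [D_eq_sum, LinearMap.sum_apply]
  refine Submodule.sum_mem _ fun α _ => ?_
  obtain ⟨z, hz⟩ := pderivE_monomialBasis i α b
  rw [hz]
  by_cases h0 : b.1 (i, α) = 0
  · simp [h0]
  · exact zsmul_mem (monomialBasis_mem_supportedOn (h b hb α h0)) _

theorem L_le {W : Submodule ℂ (CliffPoly n p)} (hvac : vac n p ∈ W)
    (hstable : ∀ i : Fin n, ∀ w ∈ W, X i w ∈ W ∧ D i w ∈ W) : L n p ≤ W :=
  sInf_le ⟨hvac, hstable⟩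

theorem vac_mem_L : vac n p ∈ L n p :=
  Submodule.mem_sInf.mpr fun _ hW => hW.1

theorem X_mem_L (i : Fin n) {v : CliffPoly n p} (hv : v ∈ L n p) : X i v ∈ L n p :=
  Submodule.mem_sInf.mpr fun W hW => (hW.2 i v (Submodule.mem_sInf.mp hv W hW)).1

theorem D_mem_L (i : Fin n) {v : CliffPoly n p} (hv : v ∈ L n p) : D i v ∈ L n p :=
  Submodule.mem_sInf.mpr fun W hW => (hW.2 i v (Submodule.mem_sInf.mp hv W hW)).2

end Generators

/-! ### Weights and parities -/

section Weights

variable {n p : ℕ}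

/-- The degrees of `x^γ` in the sets of variables `x_{i,1}, …, x_{i,p}`. -/
def rowDegree : (Fin n × Fin p →₀ ℕ) →+ (Fin n → ℕ) :=
  Finsupp.weight fun x => Pi.single x.1 1

theorem rowDegree_apply (γ : Fin n × Fin p →₀ ℕ) (i : Fin n) :
    rowDegree γ i = ∑ α, γ (i, α) := by
  rw [rowDegree, Finsupp.weight_eq_sum, Finset.sum_apply, Fintype.sum_prod_type_right]
  simp [Pi.single_apply]

theorem rowDegree_single (i : Fin n) (α : Fin p) :
    rowDegree (Finsupp.single (i, α) 1) = Pi.single i 1 := by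
  rw [rowDegree, Finsupp.weight_single, one_smul]

theorem mulXE_pderivE_add_pderivE_mulXE_tmul (i : Fin n) (α β : Fin p)
    (f : MvPolynomial (Fin n × Fin p) ℂ) (u : Cl p) :
    mulXE i α (pderivE i β (f ⊗ₜ u)) + pderivE i β (mulXE i α (f ⊗ₜ u))
      = if α = β then
          (f + (2 : ℂ) • (MvPolynomial.X (i, α) * MvPolynomial.pderiv (i, α) f)) ⊗ₜ[ℂ] u
        else 0 := by
  change (MvPolynomial.X (i, α) * MvPolynomial.pderiv (i, β) f) ⊗ₜ[ℂ] (e α * (e β * u))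
    + MvPolynomial.pderiv (i, β) (MvPolynomial.X (i, α) * f) ⊗ₜ[ℂ] (e β * (e α * u)) = _
  rw [Derivation.leibniz, smul_eq_mul, smul_eq_mul, TensorProduct.add_tmul, ← add_assoc,
    ← TensorProduct.tmul_add, ← mul_assoc, ← mul_assoc, ← add_mul, e_anticomm,
    MvPolynomial.pderiv_X]
  split_ifs with h
  · subst h
    rw [e_mul_self, one_mul, Pi.single_eq_same, mul_one, add_comm, TensorProduct.add_tmul,
      TensorProduct.smul_tmul, two_mul, two_smul]
  · rw [Pi.single_eq_of_ne fun h' => h (Prod.ext_iff.mp h').2]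
    simp

theorem X_D_add_D_X_tmul (i : Fin n) (f : MvPolynomial (Fin n × Fin p) ℂ) (u : Cl p) :
    X i (D i (f ⊗ₜ u)) + D i (X i (f ⊗ₜ u))
      = ((p : ℂ) • f + (2 : ℂ) • ∑ α, MvPolynomial.X (i, α) * MvPolynomial.pderiv (i, α) f)
        ⊗ₜ[ℂ] u := by
  simp only [X_eq_sum, D_eq_sum, LinearMap.sum_apply, map_sum]
  rw [Finset.sum_comm, ← Finset.sum_add_distrib]
  simp only [← Finset.sum_add_distrib, mulXE_pderivE_add_pderivE_mulXE_tmul,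
    Finset.sum_ite_eq, Finset.mem_univ, if_true]
  rw [← TensorProduct.sum_tmul, Finset.sum_add_distrib, Finset.smul_sum]
  simp [Nat.cast_smul_eq_nsmul]

theorem cartan_monomialBasis (i : Fin n) (b : MonomialIndex n p) :
    cartan i (monomialBasis n p b)
      = ((rowDegree b.1 i : ℂ) + (p : ℂ) / 2) • monomialBasis n p b := by
  rw [cartan, LinearMap.smul_apply, LinearMap.add_apply, Module.End.mul_apply,
    Module.End.mul_apply, monomialBasis_eq_tmul, X_D_add_D_X_tmul, TensorProduct.smul_tmul',
    TensorProduct.smul_tmul']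
  simp only [MvPolynomial.X_mul_pderiv_monomial]
  rw [← Finset.sum_smul, ← Nat.cast_smul_eq_nsmul ℂ, smul_smul, ← add_smul, smul_smul,
    rowDegree_apply]
  congr 2
  push_cast
  ring

theorem repr_cartan (i : Fin n) (v : CliffPoly n p) (b : MonomialIndex n p) :
    (monomialBasis n p).repr (cartan i v) b
      = ((rowDegree b.1 i : ℂ) + (p : ℂ) / 2) * (monomialBasis n p).repr v b := by
  have : ((monomialBasis n p).coord b).comp (cartan i)
      = ((rowDegree b.1 i : ℂ) + (p : ℂ) / 2) • (monomialBasis n p).coord b := by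
    refine (monomialBasis n p).ext fun b' => ?_
    rw [LinearMap.comp_apply, cartan_monomialBasis, map_smul, LinearMap.smul_apply,
      Module.Basis.coord_apply, Module.Basis.repr_self, Finsupp.single_apply]
    split_ifs with h
    · rw [h]
    · simp
  exact DFunLike.congr_fun this v

theorem mem_weightSpace {μ : Fin n → ℕ} {v : CliffPoly n p} :
    v ∈ weightSpace n p μ ↔ v ∈ L n p ∧ v ∈ supportedOn {b | rowDegree b.1 = μ} := by
  rw [weightSpace, Submodule.mem_inf, Submodule.mem_iInf, mem_supportedOn]
  refine and_congr_right fun _ => ?_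
  simp only [Module.End.mem_eigenspace_iff]
  constructor
  · intro h b hb
    funext i
    have hi := repr_cartan i v b
    rw [h i, map_smul, Finsupp.smul_apply, smul_eq_mul] at hi
    exact_mod_cast (add_right_cancel (mul_right_cancel₀ hb hi)).symm
  · intro h i
    refine (monomialBasis n p).ext_elem fun b => ?_
    rw [repr_cartan, map_smul, Finsupp.smul_apply, smul_eq_mul]
    by_cases hb : (monomialBasis n p).repr v b = 0
    · rw [hb, mul_zero, mul_zero]
    · rw [show rowDegree b.1 = μ from h b hb]

/-- The parities of the degrees of `x^γ` in the sets of variables `x_{1,α}, …, x_{n,α}`. -/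
def columnParity : (Fin n × Fin p →₀ ℕ) →+ (Fin p → ZMod 2) :=
  Finsupp.weight fun x => Pi.single x.2 1

theorem columnParity_single (i : Fin n) (α : Fin p) :
    columnParity (Finsupp.single (i, α) 1) = Pi.single α 1 := by
  rw [columnParity, Finsupp.weight_single, one_smul]

theorem L_le_supportedOn_columnParity : L n p ≤ supportedOn {b | b.2 = columnParity b.1} := by
  refine L_le ?_ fun i w hw => ⟨X_mem_supportedOn i ?_ hw, D_mem_supportedOn i ?_ hw⟩
  · rw [vac_eq_monomialBasis]
    exact monomialBasis_mem_supportedOn (map_zero columnParity).symm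
  · rintro ⟨γ, η⟩ (hb : η = columnParity γ) α
    exact hb ▸ (by rw [map_add, columnParity_single] :
      columnParity γ + _ = columnParity (γ + Finsupp.single (i, α) 1))
  · rintro ⟨γ, η⟩ (hb : η = columnParity γ) α (h0 : γ (i, α) ≠ 0)
    change η + _ = columnParity (γ - Finsupp.single (i, α) 1)
    obtain ⟨δ, rfl⟩ : ∃ δ, γ = δ + Finsupp.single (i, α) 1 :=
      ⟨_, (tsub_add_cancel_of_le (Finsupp.single_le_iff.mpr (Nat.one_le_iff_ne_zero.mpr h0))).symm⟩
    rw [hb, map_add, columnParity_single, shift_shift, add_tsub_cancel_right]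

end Weights

/-! ### Rotation invariance -/

section Polarization

variable {R ι κ : Type*} [CommRing R] [Fintype ι] [DecidableEq κ]

theorem polarization_X (α β γ : κ) (i : ι) :
    polarization α β (MvPolynomial.X (i, γ) : MvPolynomial (ι × κ) R)
      = if γ = β then MvPolynomial.X (i, α) else 0 := by
  classical
  simp only [polarization_apply, MvPolynomial.pderiv_X, Pi.single_apply, Prod.mk.injEq, ite_and,
    mul_ite, mul_one, mul_zero, Finset.sum_ite_eq, Finset.mem_univ, if_true]

theorem pderiv_comm {σ : Type*} (x y : σ) (f : MvPolynomial σ R) :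
    MvPolynomial.pderiv x (MvPolynomial.pderiv y f)
      = MvPolynomial.pderiv y (MvPolynomial.pderiv x f) := by
  classical
  have h : ⁅(MvPolynomial.pderiv x : Derivation R (MvPolynomial σ R) (MvPolynomial σ R)),
      MvPolynomial.pderiv y⁆ = 0 := MvPolynomial.derivation_ext fun z => by
    rw [Derivation.commutator_apply, MvPolynomial.pderiv_X, MvPolynomial.pderiv_X,
      Pi.single_apply, Pi.single_apply]
    split_ifs <;> simp
  rw [← sub_eq_zero, ← Derivation.commutator_apply, h, Derivation.zero_apply]

theorem polarization_pderiv (α β γ : κ) (i : ι) (f : MvPolynomial (ι × κ) R) :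
    polarization α β (MvPolynomial.pderiv (i, γ) f)
      = MvPolynomial.pderiv (i, γ) (polarization α β f)
        - if γ = α then MvPolynomial.pderiv (i, β) f else 0 := by
  classical
  simp only [polarization_apply, pderiv_comm (i, γ), map_sum, Derivation.leibniz, smul_eq_mul,
    MvPolynomial.pderiv_X, Pi.single_apply, Prod.mk.injEq, Finset.sum_add_distrib, mul_ite, mul_one,
    mul_zero, ite_and, Finset.sum_ite_eq', Finset.mem_univ, if_true, eq_comm (a := α)]
  rw [add_sub_cancel_right]

end Polarization

section Rotation

variable {n p : ℕ}

/-- The infinitesimal rotation `∑_i (x_{i,β} ∂_{i,α} - x_{i,α} ∂_{i,β})`. -/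
def rotation (n : ℕ) {p : ℕ} (α β : Fin p) :
    Derivation ℂ (MvPolynomial (Fin n × Fin p) ℂ) (MvPolynomial (Fin n × Fin p) ℂ) :=
  polarization β α - polarization α β

theorem rotation_apply (α β : Fin p) (f : MvPolynomial (Fin n × Fin p) ℂ) :
    rotation n α β f = polarization β α f - polarization α β f := rfl

/-- The derivation `½ [e_α e_β, ·]` of the Clifford algebra. -/
def cliffordRotation (α β : Fin p) : Module.End ℂ (Cl p) :=
  (1 / 2 : ℂ) • (LinearMap.mulLeft ℂ (e α * e β) - LinearMap.mulRight ℂ (e α * e β))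

theorem e_mul_e_mul_e (α β γ : Fin p) :
    (e α * e β * e γ : Cl p) = e γ * (e α * e β) + (2 : ℂ) • (if γ = β then e α else 0)
      - (2 : ℂ) • (if γ = α then e β else 0) := by
  have h : (e α * e β * e γ : Cl p) = e γ * (e α * e β) + e α * (e γ * e β + e β * e γ)
      - (e γ * e α + e α * e γ) * e β := by noncomm_ring
  rw [h, e_anticomm, e_anticomm]
  split_ifs <;> simp only [mul_zero, zero_mul, smul_zero, two_smul, two_mul, mul_two]

theorem cliffordRotation_e_mul (α β γ : Fin p) (u : Cl p) :
    cliffordRotation α β (e γ * u) = e γ * cliffordRotation α β u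
      + (if γ = β then e α * u else 0) - if γ = α then e β * u else 0 := by
  simp only [cliffordRotation, LinearMap.smul_apply, LinearMap.sub_apply, LinearMap.mulLeft_apply,
    LinearMap.mulRight_apply]
  rw [← mul_assoc (e α * e β), e_mul_e_mul_e, sub_mul, add_mul, smul_mul_assoc, smul_mul_assoc,
    mul_assoc (e γ), mul_assoc (e γ), mul_smul_comm, mul_sub, ite_mul, ite_mul, zero_mul]
  module

/-- The action on `𝒜` of an infinitesimal rotation in the `(α, β)` plane. -/
def rotationOp (n : ℕ) {p : ℕ} (α β : Fin p) : Module.End ℂ (CliffPoly n p) :=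
  TensorProduct.map (rotation n α β : _ →ₗ[ℂ] _) LinearMap.id
    - TensorProduct.map LinearMap.id (cliffordRotation α β)

theorem rotationOp_tmul (α β : Fin p) (f : MvPolynomial (Fin n × Fin p) ℂ) (u : Cl p) :
    rotationOp n α β (f ⊗ₜ u) = rotation n α β f ⊗ₜ u - f ⊗ₜ cliffordRotation α β u := rfl

/-- An operator `∑_γ a_γ e_γ` is invariant under rotations if `(a_γ)_γ` transforms as a vector. -/
theorem rotationOp_commute (α β : Fin p)
    (a : Fin p → Module.End ℂ (MvPolynomial (Fin n × Fin p) ℂ))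
    (ha : ∀ γ f, rotation n α β (a γ f) = a γ (rotation n α β f)
      + (if γ = α then a β f else 0) - if γ = β then a α f else 0) (v : CliffPoly n p) :
    rotationOp n α β ((∑ γ, TensorProduct.map (a γ) (LinearMap.mulLeft ℂ (e γ))) v)
      = (∑ γ, TensorProduct.map (a γ) (LinearMap.mulLeft ℂ (e γ))) (rotationOp n α β v) := by
  induction v using TensorProduct.induction_on with
  | zero => simp only [map_zero]
  | add v w hv hw => simp only [map_add, hv, hw]
  | tmul f u =>
    have hsummand : ∀ γ, rotationOp n α β (a γ f ⊗ₜ (e γ * u))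
        = TensorProduct.map (a γ) (LinearMap.mulLeft ℂ (e γ)) (rotationOp n α β (f ⊗ₜ u))
          + ((if γ = α then a β f ⊗ₜ[ℂ] (e α * u) + a α f ⊗ₜ[ℂ] (e β * u) else 0)
            - if γ = β then a β f ⊗ₜ[ℂ] (e α * u) + a α f ⊗ₜ[ℂ] (e β * u) else 0) := by
      intro γ
      rw [rotationOp_tmul, rotationOp_tmul, map_sub, TensorProduct.map_tmul,
        TensorProduct.map_tmul, LinearMap.mulLeft_apply, LinearMap.mulLeft_apply, ha,
        cliffordRotation_e_mul, TensorProduct.sub_tmul, TensorProduct.add_tmul,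
        TensorProduct.tmul_sub, TensorProduct.tmul_add]
      simp only [TensorProduct.ite_tmul, TensorProduct.tmul_ite]
      split_ifs <;> subst_vars <;> abel
    simp only [LinearMap.sum_apply, TensorProduct.map_tmul, LinearMap.mulLeft_apply, map_sum,
      hsummand]
    rw [Finset.sum_add_distrib, Finset.sum_sub_distrib]
    simp only [Finset.sum_ite_eq', Finset.mem_univ, if_true, sub_self, add_zero]

theorem rotationOp_X (α β : Fin p) (i : Fin n) (v : CliffPoly n p) :
    rotationOp n α β (X i v) = X i (rotationOp n α β v) := by
  refine rotationOp_commute α β (fun γ => LinearMap.mulLeft ℂ (MvPolynomial.X (i, γ)))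
    (fun γ f => ?_) v
  simp only [LinearMap.mulLeft_apply]
  rw [Derivation.leibniz, rotation_apply α β (MvPolynomial.X _), polarization_X, polarization_X,
    smul_eq_mul, smul_eq_mul]
  split_ifs <;> ring

theorem rotationOp_D (α β : Fin p) (i : Fin n) (v : CliffPoly n p) :
    rotationOp n α β (D i v) = D i (rotationOp n α β v) := by
  refine rotationOp_commute α β (fun γ => ((MvPolynomial.pderiv (i, γ) :
    Derivation ℂ (MvPolynomial (Fin n × Fin p) ℂ) (MvPolynomial (Fin n × Fin p) ℂ)) :
      MvPolynomial (Fin n × Fin p) ℂ →ₗ[ℂ] MvPolynomial (Fin n × Fin p) ℂ)) (fun γ f => ?_) v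
  simp only [Derivation.coeFn_coe, rotation_apply, polarization_pderiv, map_sub]
  abel

theorem rotationOp_eq_zero (α β : Fin p) {v : CliffPoly n p} (hv : v ∈ L n p) :
    rotationOp n α β v = 0 := by
  suffices h : L n p ≤ LinearMap.ker (rotationOp n α β) from h hv
  refine L_le ?_ fun i w hw => ?_
  · rw [LinearMap.mem_ker, vac, rotationOp_tmul]
    simp [cliffordRotation]
  · rw [LinearMap.mem_ker] at hw
    rw [LinearMap.mem_ker, LinearMap.mem_ker, rotationOp_X, rotationOp_D, hw, map_zero, map_zero]
    exact ⟨rfl, rfl⟩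

end Rotation

/-! ### Ballot monomials in vectors of `L_n(p)` -/

section BallotMonomial

variable {n p : ℕ}

/-- The polynomial coefficient of `e^η`. -/
def slice (n : ℕ) {p : ℕ} (η : Fin p → ZMod 2) :
    CliffPoly n p →ₗ[ℂ] MvPolynomial (Fin n × Fin p) ℂ :=
  (TensorProduct.rid ℂ _).toLinearMap ∘ₗ
    TensorProduct.map LinearMap.id ((cliffordBasis p).coord η)

theorem slice_tmul (η : Fin p → ZMod 2) (f : MvPolynomial (Fin n × Fin p) ℂ) (u : Cl p) :
    slice n η (f ⊗ₜ u) = (cliffordBasis p).repr u η • f := by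
  simp [slice]

theorem coeff_slice (η : Fin p → ZMod 2) (v : CliffPoly n p) (γ : Fin n × Fin p →₀ ℕ) :
    (slice n η v).coeff γ = (monomialBasis n p).repr v (γ, η) := by
  induction v using TensorProduct.induction_on with
  | zero => simp
  | add v w hv hw => rw [map_add, MvPolynomial.coeff_add, hv, hw, map_add, Finsupp.add_apply]
  | tmul f u =>
    rw [slice_tmul, monomialBasis_repr_tmul, MvPolynomial.coeff_smul, smul_eq_mul, mul_comm]

theorem sum_slice_tmul (v : CliffPoly n p) : ∑ η, slice n η v ⊗ₜ cliffordBasis p η = v := by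
  induction v using TensorProduct.induction_on with
  | zero => simp
  | add v w hv hw => simp only [map_add, TensorProduct.add_tmul, Finset.sum_add_distrib, hv, hw]
  | tmul f u =>
    simp only [slice_tmul, TensorProduct.smul_tmul, ← TensorProduct.tmul_sum]
    rw [(cliffordBasis p).sum_repr]

theorem rotation_slice {v : CliffPoly n p} (hv : v ∈ L n p) (α β : Fin p) (η : Fin p → ZMod 2) :
    rotation n α β (slice n η v)
      = ∑ ζ, (cliffordBasis p).repr (cliffordRotation α β (cliffordBasis p ζ)) η
          • slice n ζ v := by
  have h := congrArg (slice n η) (rotationOp_eq_zero α β hv)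
  conv_lhs at h => rw [← sum_slice_tmul v]
  simp only [map_sum, rotationOp_tmul, map_sub, slice_tmul, Module.Basis.repr_self, map_zero,
    Finset.sum_sub_distrib, sub_eq_zero] at h
  rw [← h, Finset.sum_eq_single η (fun ζ _ hζ => by rw [Finsupp.single_eq_of_ne hζ.symm, zero_smul])
    (fun h => absurd (Finset.mem_univ _) h), Finsupp.single_eq_same, one_smul]

theorem coeff_polarization_slice_comm {v : CliffPoly n p} (hv : v ∈ L n p)
    {m : Fin n × Fin p →₀ ℕ} (hm : ∀ ζ, (monomialBasis n p).repr v (m, ζ) = 0) (α β : Fin p)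
    (η : Fin p → ZMod 2) :
    (polarization α β (slice n η v)).coeff m = (polarization β α (slice n η v)).coeff m := by
  have h := congrArg (MvPolynomial.coeff m) (rotation_slice hv α β η)
  rw [rotation_apply, MvPolynomial.coeff_sub, MvPolynomial.coeff_sum] at h
  simp only [MvPolynomial.coeff_smul, coeff_slice, hm, smul_zero, Finset.sum_const_zero] at h
  exact (sub_eq_zero.mp h).symm

/-- The degrees of `x^γ` in the sets of variables `x_{1,α}, …, x_{n,α}`. -/
def columnDegree : (Fin n × Fin p →₀ ℕ) →+ (Fin p → ℕ) :=
  Finsupp.weight fun x => Pi.single x.2 1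

theorem columnDegree_move {m : Fin n × Fin p →₀ ℕ} {i : Fin n} {α : Fin p} (h : m (i, α) ≠ 0)
    (β : Fin p) :
    columnDegree (m - Finsupp.single (i, α) 1 + Finsupp.single (i, β) 1) + Pi.single α 1
      = columnDegree m + Pi.single β 1 := by
  have hsingle (κ : Fin p) :
      columnDegree (Finsupp.single (i, κ) 1) = Pi.single κ 1 := by
    rw [columnDegree, Finsupp.weight_single, one_smul]
  have hm := tsub_add_cancel_of_le (Finsupp.single_le_iff.mpr (Nat.one_le_iff_ne_zero.mpr h))
  conv_rhs => rw [← hm]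
  simp only [map_add, hsingle]
  abel

theorem toLex_lt_of_add_single {κ κ' : Fin p → ℕ} {α β : Fin p} (hαβ : α < β)
    (h : κ + Pi.single α 1 = κ' + Pi.single β 1) : toLex κ < toLex κ' := by
  have happly (γ : Fin p) : κ γ + Pi.single (M := fun _ => ℕ) α 1 γ
      = κ' γ + Pi.single (M := fun _ => ℕ) β 1 γ := congrFun h γ
  refine ⟨α, fun γ hγ => ?_, ?_⟩
  · simpa [hγ.ne, (hγ.trans hαβ).ne] using happly γ
  · have := happly α
    simp only [Pi.single_eq_same, Pi.single_eq_of_ne hαβ.ne, add_zero] at this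
    exact Nat.lt_of_succ_le this.le

/-- The part of a polynomial that has degree `κ α` in the variables `x_{1,α}, …, x_{n,α}`. -/
def columnComponent (κ : Fin p → ℕ) :
    MvPolynomial (Fin n × Fin p) ℂ →ₗ[ℂ] MvPolynomial (Fin n × Fin p) ℂ :=
  MvPolynomial.weightedHomogeneousComponent (fun x => Pi.single x.2 1) κ

theorem coeff_columnComponent (κ : Fin p → ℕ) (f : MvPolynomial (Fin n × Fin p) ℂ)
    (γ : Fin n × Fin p →₀ ℕ) :
    (columnComponent κ f).coeff γ = if columnDegree γ = κ then f.coeff γ else 0 :=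
  MvPolynomial.coeff_weightedHomogeneousComponent κ f γ

theorem coeff_polarization_columnComponent {α β : Fin p} (hαβ : α ≠ β) {κ : Fin p → ℕ}
    (f : MvPolynomial (Fin n × Fin p) ℂ) (m : Fin n × Fin p →₀ ℕ) :
    (polarization α β (columnComponent κ f)).coeff m
      = if columnDegree m + Pi.single β 1 = κ + Pi.single α 1
          then (polarization α β f).coeff m else 0 := by
  have hmove {i : Fin n} (h0 : m (i, α) ≠ 0) :
      columnDegree (m - Finsupp.single (i, α) 1 + Finsupp.single (i, β) 1) = κ
        ↔ columnDegree m + Pi.single β 1 = κ + Pi.single α 1 := by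
    rw [← columnDegree_move h0 β, add_left_inj]
  rw [coeff_polarization hαβ, coeff_polarization hαβ]
  split_ifs with hm
  · refine Finset.sum_congr rfl fun i _ => if_ctx_congr .rfl (fun _ => rfl) fun h0 => ?_
    rw [coeff_columnComponent, if_pos ((hmove h0).mpr hm)]
  · refine Finset.sum_eq_zero fun i _ => ite_eq_left_iff.mpr fun h0 => ?_
    rw [coeff_columnComponent, if_neg (mt (hmove h0).mp hm), zero_mul]

theorem polarization_columnComponent_slice_eq_zero {v : CliffPoly n p} (hv : v ∈ L n p)
    {κ : Fin p → ℕ}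
    (hκ : ∀ b, (monomialBasis n p).repr v b ≠ 0 → toLex (columnDegree b.1) ≤ toLex κ)
    (η : Fin p → ZMod 2) {α β : Fin p} (hαβ : α < β) :
    polarization α β (columnComponent κ (slice n η v)) = 0 := by
  have hrepr {m : Fin n × Fin p →₀ ℕ} (hm : toLex κ < toLex (columnDegree m))
      (ζ : Fin p → ZMod 2) : (monomialBasis n p).repr v (m, ζ) = 0 :=
    not_not.mp fun h => (hκ (m, ζ) h).not_gt hm
  ext m
  rw [coeff_polarization_columnComponent hαβ.ne, MvPolynomial.coeff_zero]
  split_ifs with hm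
  · have hlt := toLex_lt_of_add_single hαβ hm.symm
    rw [coeff_polarization_slice_comm hv (hrepr hlt), coeff_polarization hαβ.ne']
    refine Finset.sum_eq_zero fun i _ => ?_
    split_ifs with h0
    · rfl
    · have := toLex_lt_of_add_single hαβ (columnDegree_move h0 α).symm
      rw [coeff_slice, hrepr (hlt.trans this), zero_mul]
  · rfl

theorem exists_ballot_monomial {v : CliffPoly n p} (hv : v ∈ L n p) (hv0 : v ≠ 0) :
    ∃ b, (monomialBasis n p).repr v b ≠ 0 ∧ IsBallot b.1 := by
  have hne : ((monomialBasis n p).repr v).support.Nonempty :=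
    Finsupp.support_nonempty_iff.mpr ((monomialBasis n p).repr.map_ne_zero_iff.mpr hv0)
  obtain ⟨⟨γ₀, η⟩, hγ₀, hmax⟩ :=
    Finset.exists_max_image _ (fun b => toLex (columnDegree b.1)) hne
  set f := columnComponent (columnDegree γ₀) (slice n η v) with hf
  have hcoeff : ∀ γ, f.coeff γ ≠ 0 → (monomialBasis n p).repr v (γ, η) ≠ 0 := fun γ hγ => by
    rw [hf, coeff_columnComponent, coeff_slice] at hγ
    exact (ite_ne_right_iff.mp hγ).2
  have hγ₀f : γ₀ ∈ f.support := by
    rw [MvPolynomial.mem_support_iff, hf, coeff_columnComponent, if_pos rfl, coeff_slice]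
    exact Finsupp.mem_support_iff.mp hγ₀
  obtain ⟨γ, hγ, hγmax⟩ := Finset.exists_max_image f.support rowReading ⟨γ₀, hγ₀f⟩
  refine ⟨(γ, η), hcoeff γ (MvPolynomial.mem_support_iff.mp hγ), ?_⟩
  refine isBallot_of_polarization_eq_zero (f := f) (fun α β hαβ => ?_) hγ hγmax
  exact polarization_columnComponent_slice_eq_zero hv
    (fun b hb => hmax b (Finsupp.mem_support_iff.mpr hb)) η hαβ

end BallotMonomial

/-! ### Column operators -/

section Columns

variable {n p k : ℕ}

/-- The operator `∏_r x_{I_r,C_r} e_{C_r}`: the summand of `∏_r X_{I_r}` in which the `r`-th factor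
contributes its summand with index `C_r`. -/
def columnTerm (I : Fin k → Fin n) (C : Fin k → Fin p) : Module.End ℂ (CliffPoly n p) :=
  (List.ofFn fun r => mulXE (I r) (C r)).prod

/-- The exponent of `∏_r x_{I_r,C_r}`. -/
def columnExponent (I : Fin k → Fin n) (C : Fin k → Fin p) : Fin n × Fin p →₀ ℕ :=
  ∑ r, Finsupp.single (I r, C r) 1

theorem columnTerm_succ (I : Fin (k + 1) → Fin n) (C : Fin (k + 1) → Fin p) :
    columnTerm I C = mulXE (I 0) (C 0) * columnTerm (fun r => I r.succ) fun r => C r.succ := by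
  rw [columnTerm, List.ofFn_succ, List.prod_cons]
  rfl

theorem columnExponent_succ (I : Fin (k + 1) → Fin n) (C : Fin (k + 1) → Fin p) :
    columnExponent I C = Finsupp.single (I 0, C 0) 1
      + columnExponent (fun r => I r.succ) fun r => C r.succ :=
  Fin.sum_univ_succ _

theorem columnExponent_comp_perm (I : Fin k → Fin n) (C : Fin k → Fin p)
    (σ : Equiv.Perm (Fin k)) :
    columnExponent (fun r => I (σ r)) (fun r => C (σ r)) = columnExponent I C :=
  Equiv.sum_comp σ fun r => Finsupp.single (I r, C r) 1

theorem rowDegree_columnExponent (I : Fin k → Fin n) (C : Fin k → Fin p) :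
    rowDegree (columnExponent I C) = ∑ r, Pi.single (I r) 1 := by
  rw [columnExponent, map_sum]
  exact Finset.sum_congr rfl fun r _ => rowDegree_single _ _

theorem columnTerm_eq_map (I : Fin k → Fin n) (C : Fin k → Fin p) :
    columnTerm I C = TensorProduct.map
      (LinearMap.mulLeft ℂ (MvPolynomial.monomial (columnExponent I C) (1 : ℂ)))
      (LinearMap.mulLeft ℂ (List.ofFn fun r => (e (C r) : Cl p)).prod) := by
  induction k with
  | zero =>
    refine TensorProduct.ext' fun f u => ?_
    simp [columnTerm, columnExponent]
  | succ k ih =>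
    rw [columnTerm_succ, ih, mulXE, columnExponent_succ]
    refine TensorProduct.ext' fun f u => ?_
    rw [Module.End.mul_apply, TensorProduct.map_tmul, TensorProduct.map_tmul,
      TensorProduct.map_tmul]
    simp only [LinearMap.mulLeft_apply, List.ofFn_succ, List.prod_cons, ← mul_assoc]
    rw [MvPolynomial.X, MvPolynomial.monomial_mul, one_mul]

theorem columnTerm_monomialBasis (I : Fin k → Fin n) (C : Fin k → Fin p) (b : MonomialIndex n p) :
    ∃ z : ℤˣ, columnTerm I C (monomialBasis n p b) = (z : ℤ) • monomialBasis n p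
      (b.1 + columnExponent I C, b.2 + columnParity (columnExponent I C)) := by
  induction k with
  | zero => exact ⟨1, by simp [columnTerm, columnExponent]⟩
  | succ k ih =>
    obtain ⟨z, hz⟩ := ih (fun r => I r.succ) (fun r => C r.succ)
    obtain ⟨z', hz'⟩ := mulXE_monomialBasis (I 0) (C 0)
      (b.1 + columnExponent (fun r => I r.succ) (fun r => C r.succ),
        b.2 + columnParity (columnExponent (fun r => I r.succ) (fun r => C r.succ)))
    refine ⟨z * z', ?_⟩
    rw [columnTerm_succ, Module.End.mul_apply, hz, map_zsmul, hz', smul_smul, columnExponent_succ,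
      map_add, columnParity_single, Units.val_mul, add_comm (Finsupp.single _ _),
      add_comm (Pi.single _ _), add_assoc, add_assoc]

theorem prod_ofFn_X (I : Fin k → Fin n) :
    (List.ofFn fun r => (X (I r) : Module.End ℂ (CliffPoly n p))).prod
      = ∑ C : Fin k → Fin p, columnTerm I C := by
  induction k with
  | zero => simp [columnTerm]
  | succ k ih =>
    rw [List.ofFn_succ, List.prod_cons, ih, X_eq_sum, Finset.sum_mul_sum,
      ← (Fin.consEquiv fun _ : Fin (k + 1) => Fin p).sum_comp, Fintype.sum_prod_type]
    refine Finset.sum_congr rfl fun α _ => Finset.sum_congr rfl fun C _ => ?_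
    simp [columnTerm_succ, Fin.consEquiv]

theorem sum_sign_smul_columnTerm (I : Fin k → Fin n) (C : Fin k → Fin p) :
    ∑ σ : Equiv.Perm (Fin k), Equiv.Perm.sign σ • columnTerm (fun r => I (σ r)) (fun r => C (σ r))
      = TensorProduct.map
        (LinearMap.mulLeft ℂ (MvPolynomial.monomial (columnExponent I C) (1 : ℂ)))
        (LinearMap.mulLeft ℂ (∑ σ : Equiv.Perm (Fin k),
          Equiv.Perm.sign σ • (List.ofFn fun r => (e (C (σ r)) : Cl p)).prod)) := by
  refine TensorProduct.ext' fun f u => ?_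
  simp only [columnTerm_eq_map, columnExponent_comp_perm, LinearMap.sum_apply, Units.smul_def,
    LinearMap.smul_apply, TensorProduct.map_tmul, LinearMap.mulLeft_apply, Finset.sum_mul,
    smul_mul_assoc, TensorProduct.tmul_sum, TensorProduct.tmul_smul]

theorem sum_sign_smul_columnTerm_of_injective (I : Fin k → Fin n) {C : Fin k → Fin p}
    (hC : Function.Injective C) :
    ∑ σ : Equiv.Perm (Fin k), Equiv.Perm.sign σ • columnTerm (fun r => I (σ r)) (fun r => C (σ r))
      = k.factorial • columnTerm I C := by
  rw [sum_sign_smul_columnTerm, sum_sign_smul_prod_of_injective (fun _ _ => e_mul_e_of_ne) hC,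
    columnTerm_eq_map]
  refine TensorProduct.ext' fun f u => ?_
  simp only [LinearMap.smul_apply, TensorProduct.map_tmul, LinearMap.mulLeft_apply, smul_mul_assoc,
    TensorProduct.tmul_smul]

theorem sum_sign_smul_columnTerm_of_not_injective (I : Fin k → Fin n) {C : Fin k → Fin p}
    (hC : ¬Function.Injective C) :
    ∑ σ : Equiv.Perm (Fin k), Equiv.Perm.sign σ • columnTerm (fun r => I (σ r)) (fun r => C (σ r))
      = 0 := by
  rw [sum_sign_smul_columnTerm, sum_sign_smul_prod_of_not_injective e hC,
    LinearMap.mulLeft_zero_eq_zero, TensorProduct.map_zero_right]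

/-- The operator `X_I / k!`, in which only the summands with distinct Clifford generators
survive. -/
def columnSum (I : Fin k → Fin n) : Module.End ℂ (CliffPoly n p) :=
  ∑ C : Fin k ↪ Fin p, columnTerm I C

theorem columnOp_eq (I : Fin k → Fin n) :
    (columnOp I : Module.End ℂ (CliffPoly n p)) = (k.factorial : ℂ) • columnSum I := by
  have hX (σ : Equiv.Perm (Fin k)) :
      (List.ofFn fun r => (X (I (σ r)) : Module.End ℂ (CliffPoly n p))).prod
        = ∑ C : Fin k → Fin p, columnTerm (fun r => I (σ r)) (fun r => C (σ r)) := by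
    rw [prod_ofFn_X]
    exact (Equiv.sum_comp (Equiv.arrowCongr σ.symm (Equiv.refl (Fin p))) _).symm
  have hsign (σ : Equiv.Perm (Fin k)) (T : Module.End ℂ (CliffPoly n p)) :
      ((Equiv.Perm.sign σ : ℤ) : ℂ) • T = Equiv.Perm.sign σ • T :=
    Int.cast_smul_eq_zsmul ℂ _ T
  simp only [columnOp, hX, hsign, Finset.smul_sum]
  rw [Finset.sum_comm, columnSum, Nat.cast_smul_eq_nsmul, Finset.smul_sum]
  refine (Finset.sum_of_injOn DFunLike.coe DFunLike.coe_injective.injOn (fun _ _ => ?_)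
    (fun C _ hC => ?_) fun C _ => ?_).symm
  · exact Finset.mem_coe.mpr (Finset.mem_univ _)
  · refine sum_sign_smul_columnTerm_of_not_injective I fun h => hC ?_
    exact ⟨⟨C, h⟩, Finset.mem_coe.mpr (Finset.mem_univ _), rfl⟩
  · exact (sum_sign_smul_columnTerm_of_injective I C.injective).symm

theorem columnSum_mem_integralVectors (I : Fin k → Fin n) {v : CliffPoly n p}
    (hv : v ∈ integralVectors n p) : columnSum I v ∈ integralVectors n p := by
  refine map_mem_integralVectors _ (fun b => ?_) hv
  rw [columnSum, LinearMap.sum_apply]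
  refine Submodule.sum_mem _ fun C _ => ?_
  obtain ⟨z, hz⟩ := columnTerm_monomialBasis I C b
  exact hz ▸ Submodule.smul_mem _ _ (monomialBasis_mem_integralVectors _)

theorem prod_ofFn_X_mem_L (I : Fin k → Fin n) {v : CliffPoly n p} (hv : v ∈ L n p) :
    (List.ofFn fun r => (X (I r) : Module.End ℂ (CliffPoly n p))).prod v ∈ L n p := by
  induction k with
  | zero => simpa using hv
  | succ k ih =>
    rw [List.ofFn_succ, List.prod_cons, Module.End.mul_apply]
    exact X_mem_L _ (ih fun r => I r.succ)

theorem columnOp_mem_L (I : Fin k → Fin n) {v : CliffPoly n p} (hv : v ∈ L n p) :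
    columnOp I v ∈ L n p := by
  rw [columnOp, LinearMap.sum_apply]
  exact Submodule.sum_mem _ fun σ _ =>
    Submodule.smul_mem _ _ (prod_ofFn_X_mem_L (fun r => I (σ r)) hv)

end Columns

/-! ### Dominated monomials -/

section Dominance

variable {n p k : ℕ}

/-- The number of variables `x_{i,α}`, `i < a` and `α < r`, in `x^γ`, as a function of `a`
and `r`. -/
def cornerSum : (Fin n × Fin p →₀ ℕ) →+ (ℕ → ℕ → ℕ) :=
  Finsupp.weight fun x a r => if (x.1 : ℕ) < a ∧ (x.2 : ℕ) < r then 1 else 0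

theorem cornerSum_columnExponent (I : Fin k → Fin n) (C : Fin k → Fin p) (a r : ℕ) :
    cornerSum (columnExponent I C) a r
      = (Finset.univ.filter fun s => (I s : ℕ) < a ∧ (C s : ℕ) < r).card := by
  simp only [columnExponent, map_sum, cornerSum, Finsupp.weight_single, one_smul, Finset.sum_apply,
    Finset.card_filter]

theorem exists_lt_iff_of_monotone {I : Fin k → Fin n} (hI : Monotone I) (a : ℕ) :
    ∃ m ≤ k, ∀ s, (I s : ℕ) < a ↔ (s : ℕ) < m := by
  set S := Finset.univ.filter fun s => (I s : ℕ) < a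
  refine ⟨S.card, (Finset.card_filter_le _ _).trans_eq (Finset.card_fin k),
    fun s => ⟨fun hs => ?_, ?_⟩⟩
  · have hsub : Finset.Iic s ⊆ S := fun t ht => by
      simpa [S] using lt_of_le_of_lt (Fin.le_def.mp (hI (Finset.mem_Iic.mp ht))) hs
    simpa using Finset.card_le_card hsub
  · contrapose!
    intro hs
    have hsub : S ⊆ Finset.Iio s := fun t ht => Finset.mem_Iio.mpr <| by
      by_contra! hst
      exact (hs.trans (Fin.le_def.mp (hI hst))).not_gt (Finset.mem_filter.mp ht).2
    simpa using Finset.card_le_card hsub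

theorem card_filter_val_lt_le {C : Fin k → Fin p} (hC : Function.Injective C) (r : ℕ) :
    (Finset.univ.filter fun s => (C s : ℕ) < r).card ≤ r := by
  simpa using Finset.card_le_card_of_injOn (t := Finset.range r) (fun s => (C s : ℕ))
    (fun s hs => by simpa using hs) (Fin.val_injective.comp hC).injOn

theorem cornerSum_columnExponent_le {I : Fin k → Fin n} (hI : Monotone I) {C : Fin k → Fin p}
    (hC : Function.Injective C) (hk : k ≤ p) :
    cornerSum (columnExponent I C) ≤ cornerSum (columnExponent I (Fin.castLE hk)) := by
  intro a r
  obtain ⟨m, hmk, hm⟩ := exists_lt_iff_of_monotone hI a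
  simp only [cornerSum_columnExponent, hm, Fin.val_castLE, ← lt_min_iff]
  rw [Fin.card_filter_val_lt, min_eq_right (min_le_of_left_le hmk), le_min_iff]
  constructor
  · refine (Finset.card_le_card (Finset.monotone_filter_right _ fun s _ hs => hs.1)).trans ?_
    rw [Fin.card_filter_val_lt]
    exact min_le_right _ _
  · exact (Finset.card_le_card (Finset.monotone_filter_right _ fun s _ hs => hs.2)).trans
      (card_filter_val_lt_le hC r)

theorem eq_self_of_injective_of_le {α : Type*} [PartialOrder α] [WellFoundedLT α] {f : α → α}
    (hf : Function.Injective f) (hle : ∀ a, f a ≤ a) (a : α) : f a = a := by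
  induction a using WellFoundedLT.induction with
  | ind a ih =>
    by_contra hne
    exact hne (hf (ih (f a) (lt_of_le_of_ne (hle a) hne)))

theorem cornerSum_columnExponent_lt {I : Fin k → Fin n} (hI : StrictMono I) {C : Fin k → Fin p}
    (hC : Function.Injective C) {hk : k ≤ p} (h : C ≠ Fin.castLE hk) :
    cornerSum (columnExponent I C) < cornerSum (columnExponent I (Fin.castLE hk)) := by
  refine lt_of_le_of_ne (cornerSum_columnExponent_le hI.monotone hC hk) fun heq => h ?_
  have hle (s : Fin k) : (C s : ℕ) ≤ s := by
    have hIs (t : Fin k) : (I t : ℕ) < I s + 1 ↔ (t : ℕ) < s + 1 := by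
      rw [Nat.lt_succ_iff, Nat.lt_succ_iff, ← Fin.le_def, ← Fin.le_def, hI.le_iff_le]
    have hcard := congrFun (congrFun heq (I s + 1)) (s + 1)
    simp only [cornerSum_columnExponent, hIs, Fin.val_castLE, and_self] at hcard
    have hsub := Finset.eq_of_subset_of_card_le
      (Finset.monotone_filter_right Finset.univ fun t _ ht => ht.1) hcard.ge
    have hs : s ∈ Finset.univ.filter fun t : Fin k => (t : ℕ) < s + 1 := by simp
    rw [← hsub] at hs
    exact Nat.lt_succ_iff.mp (Finset.mem_filter.mp hs).2.2
  have hinj : Function.Injective fun s => (⟨C s, (hle s).trans_lt s.isLt⟩ : Fin k) :=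
    fun s t hst => hC (Fin.ext (Fin.mk.inj hst))
  exact funext fun s => Fin.ext (Fin.mk.inj (eq_self_of_injective_of_le hinj hle s))

/-- The monomials with the row degrees of `x^γ` that are strictly dominated by `x^γ`. -/
def dominated (γ : Fin n × Fin p →₀ ℕ) : Set (MonomialIndex n p) :=
  {b | cornerSum b.1 < cornerSum γ ∧ rowDegree b.1 = rowDegree γ}

theorem columnTerm_mem_supportedOn_dominated {I : Fin k → Fin n} {C R : Fin k → Fin p}
    {γ : Fin n × Fin p →₀ ℕ} {b : MonomialIndex n p} (hrow : rowDegree b.1 = rowDegree γ)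
    (h : cornerSum (b.1 + columnExponent I C) < cornerSum (γ + columnExponent I R)) :
    columnTerm I C (monomialBasis n p b)
      ∈ supportedOn (dominated (γ + columnExponent I R)) := by
  obtain ⟨z, hz⟩ := columnTerm_monomialBasis I C b
  rw [hz]
  refine Submodule.smul_of_tower_mem _ _ (monomialBasis_mem_supportedOn ⟨h, ?_⟩)
  rw [map_add, map_add, hrow, rowDegree_columnExponent, rowDegree_columnExponent]

theorem columnSum_mem_supportedOn_dominated {I : Fin k → Fin n} (hI : Monotone I) (hk : k ≤ p)
    {γ : Fin n × Fin p →₀ ℕ} {v : CliffPoly n p} (hv : v ∈ supportedOn (dominated γ)) :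
    columnSum I v ∈ supportedOn (dominated (γ + columnExponent I (Fin.castLE hk))) := by
  refine map_mem_supportedOn _ (fun b hb => ?_) hv
  rw [columnSum, LinearMap.sum_apply]
  refine Submodule.sum_mem _ fun C _ => columnTerm_mem_supportedOn_dominated hb.2 ?_
  rw [map_add, map_add]
  exact add_lt_add_of_lt_of_le hb.1 (cornerSum_columnExponent_le hI C.injective hk)

theorem columnSum_sub_columnTerm_mem {I : Fin k → Fin n} (hI : StrictMono I) (hk : k ≤ p)
    (b : MonomialIndex n p) :
    columnSum I (monomialBasis n p b) - columnTerm I (Fin.castLE hk) (monomialBasis n p b)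
      ∈ supportedOn (dominated (b.1 + columnExponent I (Fin.castLE hk))) := by
  classical
  rw [columnSum, LinearMap.sum_apply, ← Finset.add_sum_erase _ _
    (Finset.mem_univ (Fin.castLEEmb hk)), Fin.coe_castLEEmb, add_sub_cancel_left]
  refine Submodule.sum_mem _ fun C hC => columnTerm_mem_supportedOn_dominated rfl ?_
  rw [map_add, map_add]
  exact add_lt_add_right (cornerSum_columnExponent_lt hI C.injective
    (DFunLike.coe_injective.ne (Finset.ne_of_mem_erase hC))) _

end Dominance

/-! ### Tableaux and their exponents -/

section ColumnCount

variable {n p : ℕ}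

/-- The number of variables `x_{i,r}` with `i < a` in `x^γ`, counted with multiplicity. For the
exponent of a tableau this is the length of the `r`-th row of the `a`-th subtableau. -/
def columnCount : (Fin n × Fin p →₀ ℕ) →+ (ℕ → ℕ → ℕ) :=
  Finsupp.weight fun x a r => if (x.1 : ℕ) < a ∧ (x.2 : ℕ) = r then 1 else 0

theorem cornerSum_eq_sum_columnCount (γ : Fin n × Fin p →₀ ℕ) (a r : ℕ) :
    cornerSum γ a r = ∑ j ∈ Finset.range r, columnCount γ a j := by
  simp only [cornerSum, columnCount, Finsupp.weight_apply, Finsupp.sum, Finset.sum_apply,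
    Pi.smul_apply, smul_eq_mul]
  rw [Finset.sum_comm]
  refine Finset.sum_congr rfl fun x _ => ?_
  simp [ite_and]

theorem columnCount_val (γ : Fin n × Fin p →₀ ℕ) (a : ℕ) (α : Fin p) :
    columnCount γ a α = ∑ i : Fin n with i.val < a, γ (i, α) := by
  rw [columnCount, Finsupp.weight_apply, Finsupp.sum_fintype _ _ (by simp), Finset.sum_apply,
    Finset.sum_apply, Fintype.sum_prod_type, Finset.sum_filter]
  refine Finset.sum_congr rfl fun i _ => ?_
  simp [Fin.val_inj, ite_and]

theorem columnCount_eq_zero (γ : Fin n × Fin p →₀ ℕ) (a : ℕ) {r : ℕ} (hr : p ≤ r) :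
    columnCount γ a r = 0 := by
  simp only [columnCount, Finsupp.weight_apply, Finsupp.sum, Finset.sum_apply, Pi.smul_apply]
  refine Finset.sum_eq_zero fun x _ => ?_
  rw [if_neg fun h => (x.2.isLt.trans_le hr).ne h.2, smul_zero]

theorem columnCount_zero_left (γ : Fin n × Fin p →₀ ℕ) : columnCount γ 0 = 0 := by
  ext r
  simp [columnCount, Finsupp.weight_apply, Finsupp.sum]

theorem columnCount_mono (γ : Fin n × Fin p →₀ ℕ) : Monotone (columnCount γ) := by
  intro a b hab r
  obtain hr | hr := lt_or_ge r p
  · rw [columnCount_val γ a ⟨r, hr⟩, columnCount_val γ b ⟨r, hr⟩]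
    exact Finset.sum_le_sum_of_subset
      (Finset.monotone_filter_right _ fun i _ hi => hi.trans_le hab)
  · simp only [columnCount_eq_zero γ _ hr, le_refl]

theorem columnCount_le (γ : Fin n × Fin p →₀ ℕ) (a : ℕ) : columnCount γ a ≤ columnCount γ n := by
  intro r
  obtain hr | hr := lt_or_ge r p
  · rw [columnCount_val γ a ⟨r, hr⟩, columnCount_val γ n ⟨r, hr⟩]
    exact Finset.sum_le_sum_of_subset (Finset.monotone_filter_right _ fun i _ _ => i.isLt)
  · simp only [columnCount_eq_zero γ _ hr, le_refl]

theorem columnCount_succ (γ : Fin n × Fin p →₀ ℕ) (i : Fin n) (α : Fin p) :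
    columnCount γ (i + 1) α = γ (i, α) + columnCount γ i α := by
  have h : Finset.univ.filter (fun j : Fin n => j.val < i.val + 1)
      = insert i (Finset.univ.filter fun j => j.val < i.val) := by
    ext j
    simp [Fin.ext_iff, le_iff_eq_or_lt]
  rw [columnCount_val, columnCount_val, h, Finset.sum_insert (by simp)]

theorem columnCount_injective :
    Function.Injective (columnCount : (Fin n × Fin p →₀ ℕ) →+ (ℕ → ℕ → ℕ)) := by
  intro γ δ h
  ext ⟨i, α⟩
  have hγ := columnCount_succ γ i α
  rwa [h, columnCount_succ, add_left_inj, eq_comm] at hγ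

theorem IsBallot.columnCount_succ_le {γ : Fin n × Fin p →₀ ℕ} (hγ : IsBallot γ) (a r : ℕ) :
    columnCount γ (a + 1) (r + 1) ≤ columnCount γ a r := by
  obtain hr | hr := le_or_gt p (r + 1)
  · simp only [columnCount_eq_zero γ _ hr, zero_le]
  have key : ∀ a < n, columnCount γ (a + 1) (r + 1) ≤ columnCount γ a r := by
    intro a ha
    have h := hγ (show (⟨r, by omega⟩ : Fin p) < ⟨r + 1, hr⟩ from Nat.lt_succ_self r) ⟨a, ha⟩
    rw [← Finset.filter_ge_eq_Iic, ← Finset.filter_gt_eq_Iio] at h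
    simpa [columnCount_val γ _ ⟨r + 1, hr⟩, columnCount_val γ _ ⟨r, by omega⟩, Fin.le_def,
      Fin.lt_def, Nat.lt_succ_iff] using h
  obtain ha | ha := lt_or_ge a n
  · exact key a ha
  refine (columnCount_le γ _ _).trans ?_
  cases n with
  | zero => simp only [columnCount_zero_left, Pi.zero_apply, zero_le]
  | succ n => exact (key n n.lt_succ_self).trans (columnCount_mono γ (by omega) r)

end ColumnCount

theorem eq_of_rowLen_eq {κ ν : YoungDiagram} (h : κ.rowLen = ν.rowLen) : κ = ν := by
  ext ⟨r, c⟩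
  rw [YoungDiagram.mem_cells, YoungDiagram.mem_cells, YoungDiagram.mem_iff_lt_rowLen,
    YoungDiagram.mem_iff_lt_rowLen, h]

theorem exists_youngDiagram_rowLen_eq {f : ℕ → ℕ} (hf : Antitone f) {p : ℕ} (hp : f p = 0) :
    ∃ κ : YoungDiagram, κ.rowLen = f := by
  let κ : YoungDiagram :=
    { cells := (Finset.range p ×ˢ Finset.range (f 0)).filter fun b => b.2 < f b.1
      isLowerSet := by
        rintro ⟨r, c⟩ ⟨r', c'⟩ hle h
        obtain ⟨hr, hc⟩ := Prod.mk_le_mk.mp hle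
        simp only [Finset.coe_filter, Finset.mem_product, Finset.mem_range,
          Set.mem_ofPred_eq] at h ⊢
        have := hf hr
        omega }
  refine ⟨κ, funext fun r => eq_of_forall_lt_iff fun c => ?_⟩
  have hlt : c < f r → r < p ∧ c < f 0 := fun h =>
    ⟨lt_of_not_ge fun hr => by simpa [hp] using h.trans_le (hf hr), h.trans_le (hf r.zero_le)⟩
  rw [← YoungDiagram.mem_iff_lt_rowLen, ← YoungDiagram.mem_cells]
  simpa [κ] using hlt

namespace Tableau

variable {n p : ℕ}

theorem mem_subshape {A : Tableau n p} {k r c : ℕ} :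
    (r, c) ∈ A.subshape k ↔ (r, c) ∈ A.shape ∧ A.entry r c < k := by
  rw [← YoungDiagram.mem_cells]
  simp [subshape]

theorem entry_le_of_subshape_eq {A B : Tableau n p}
    (h : ∀ i : Fin n, A.subshape (i + 1) = B.subshape (i + 1)) {r c : ℕ} (hrc : (r, c) ∈ A.shape) :
    (r, c) ∈ B.shape ∧ B.entry r c ≤ A.entry r c := by
  have hA : (r, c) ∈ A.subshape (A.entry r c + 1) := mem_subshape.mpr ⟨hrc, Nat.lt_succ_self _⟩
  rw [h ⟨_, A.entry_lt hrc⟩, mem_subshape] at hA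
  exact ⟨hA.1, Nat.lt_succ_iff.mp hA.2⟩

theorem ext_of_subshape {A B : Tableau n p}
    (h : ∀ i : Fin n, A.subshape (i + 1) = B.subshape (i + 1)) : A = B := by
  have hAB {r c} := entry_le_of_subshape_eq (r := r) (c := c) h
  have hBA {r c} := entry_le_of_subshape_eq (r := r) (c := c) fun i => (h i).symm
  obtain ⟨κ, a, _, _⟩ := A
  obtain ⟨ν, b, _, _⟩ := B
  obtain rfl : κ = ν := by
    ext ⟨r, c⟩
    exact ⟨fun hrc => (hAB hrc).1, fun hrc => (hBA hrc).1⟩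
  obtain rfl : a = b := by
    ext r c
    by_cases hrc : (r, c) ∈ κ
    · exact le_antisymm (hBA hrc).2 (hAB hrc).2
    · rw [a.zeros hrc, b.zeros hrc]
  rfl

/-- The exponent of the `x`-part of the leading term of `ω̃_A(p)`. -/
def exponent (A : Tableau n p) : Fin n × Fin p →₀ ℕ :=
  ∑ b : A.shape.cells, Finsupp.single
    (⟨A.entry b.1.1 b.1.2, A.entry_lt ((YoungDiagram.mem_cells _).mp b.2)⟩, A.rowFilling b) 1

theorem columnCount_exponent (A : Tableau n p) (k : ℕ) :
    columnCount A.exponent k = (A.subshape k).rowLen := by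
  ext r
  have hcells : A.shape.cells.filter (fun b => A.entry b.1 b.2 < k ∧ b.1 = r)
      = (A.subshape k).row r := by
    ext ⟨r', c⟩
    simp [YoungDiagram.row, subshape, and_assoc]
  rw [YoungDiagram.rowLen_eq_card, ← hcells, Finset.card_filter, ← Finset.sum_coe_sort]
  simp only [exponent, map_sum, columnCount, Finsupp.weight_single, one_smul, Finset.sum_apply,
    rowFilling]

theorem cornerSum_exponent (A : Tableau n p) (k r : ℕ) :
    cornerSum A.exponent k r = ∑ j ∈ Finset.range r, (A.subshape k).rowLen j := by
  rw [cornerSum_eq_sum_columnCount, columnCount_exponent]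

theorem rowDegree_exponent (A : Tableau n p) : rowDegree A.exponent = A.weight := by
  ext i
  rw [weight, Finset.card_filter, ← Finset.sum_coe_sort]
  simp [exponent, map_sum, rowDegree_single, Pi.single_apply, Fin.ext_iff, eq_comm]

theorem exponent_injective : Function.Injective (exponent : Tableau n p → _) := by
  intro A B h
  refine ext_of_subshape fun i => eq_of_rowLen_eq ?_
  rw [← columnCount_exponent, h, columnCount_exponent]

theorem card_subshape (A : Tableau n p) (k : ℕ) :
    (A.subshape k).card = ∑ i : Fin n with i.val < k, A.weight i := by
  simp only [weight, Finset.card_filter, YoungDiagram.card, subshape]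
  rw [Finset.sum_comm]
  refine Finset.sum_congr rfl fun b hb => ?_
  obtain ⟨i, hi⟩ : ∃ i : Fin n, (i : ℕ) = A.entry b.1 b.2 :=
    ⟨⟨_, A.entry_lt ((YoungDiagram.mem_cells b).mp hb)⟩, rfl⟩
  simp [← hi, Fin.val_inj]

/-- The row lengths of the successive subtableaux, compared lexicographically. -/
def shapeKey (A : Tableau n p) : Lex (Fin n → Lex (ℕ → ℕ)) :=
  toLex fun i => toLex (A.subshape (i + 1)).rowLen

theorem shapeKey_injective : Function.Injective (shapeKey : Tableau n p → _) := fun _ _ h =>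
  ext_of_subshape fun i => eq_of_rowLen_eq (congrFun h i)

theorem lt_iff_exists_of_weight_eq {A B : Tableau n p} (h : A.weight = B.weight) :
    A < B ↔ ∃ k : Fin n, (∀ l < k, A.subshape (l + 1) = B.subshape (l + 1)) ∧
      partitionLT (A.subshape (k + 1)) (B.subshape (k + 1)) := by
  have hirrefl : ¬ weightLT A.weight B.weight := by simp [weightLT, h]
  change weightLT _ _ ∨ _ ↔ _
  rw [or_iff_right hirrefl, and_iff_right h]
  constructor
  · rintro ⟨k, hk, hl, hlt⟩
    obtain ⟨k, rfl⟩ := Nat.exists_eq_add_of_le' (Finset.mem_Icc.mp hk).1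
    refine ⟨⟨k, (Finset.mem_Icc.mp hk).2⟩, fun l hlk => hl _ ?_ (Nat.succ_lt_succ hlk), hlt⟩
    exact Finset.mem_Icc.mpr ⟨Nat.succ_pos _, l.isLt⟩
  · rintro ⟨k, hl, hlt⟩
    refine ⟨k + 1, Finset.mem_Icc.mpr ⟨Nat.succ_pos _, k.isLt⟩, fun l hl' hlk => ?_, hlt⟩
    obtain ⟨l, rfl⟩ := Nat.exists_eq_add_of_le' (Finset.mem_Icc.mp hl').1
    exact hl ⟨l, (Finset.mem_Icc.mp hl').2⟩ (Nat.lt_of_succ_lt_succ hlk)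

theorem lt_iff_shapeKey_lt {A B : Tableau n p} (h : A.weight = B.weight) :
    A < B ↔ A.shapeKey < B.shapeKey := by
  rw [lt_iff_exists_of_weight_eq h]
  refine exists_congr fun k => and_congr (forall₂_congr fun l _ => ?_) ?_
  · exact ⟨fun hl => congrArg (fun κ => toLex κ.rowLen) hl, eq_of_rowLen_eq⟩
  · have hcard : (A.subshape (k + 1)).card = (B.subshape (k + 1)).card := by
      rw [card_subshape, card_subshape, h]
    rw [partitionLT, or_iff_right hcard.not_lt, and_iff_right hcard]
    rfl

theorem not_lt_of_cornerSum_le {A B : Tableau n p} (h : A.weight = B.weight)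
    (hle : cornerSum A.exponent ≤ cornerSum B.exponent) : ¬ B < A := by
  rw [lt_iff_exists_of_weight_eq h.symm]
  rintro ⟨k, -, hlt | ⟨-, j, hj, hlt⟩⟩
  · rw [card_subshape, card_subshape, h] at hlt
    exact lt_irrefl _ hlt
  · have hkj := hle (k + 1) (j + 1)
    rw [cornerSum_exponent, cornerSum_exponent, Finset.sum_range_succ, Finset.sum_range_succ,
      Finset.sum_congr rfl fun i hi => hj i (Finset.mem_range.mp hi)] at hkj
    exact hlt.not_ge (le_of_add_le_add_left hkj)

theorem finite_setOf_weight_eq (μ : Fin n → ℕ) : {A : Tableau n p | A.weight = μ}.Finite := by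
  refine Set.Finite.of_finite_image (f := exponent) ?_ exponent_injective.injOn
  refine (Set.finite_Iic (Finsupp.equivFunOnFinite.symm fun x : Fin n × Fin p => μ x.1)).subset ?_
  rintro _ ⟨A, rfl, rfl⟩ ⟨i, α⟩
  rw [Finsupp.equivFunOnFinite_symm_apply_apply, ← rowDegree_exponent, rowDegree_apply]
  exact Finset.single_le_sum (f := fun α => A.exponent (i, α)) (fun _ _ => Nat.zero_le _)
    (Finset.mem_univ α)

theorem exists_isEnumeration (μ : Fin n → ℕ) :
    ∃ (m : ℕ) (A : Fin m → Tableau n p), IsEnumeration μ A := by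
  classical
  have hfin := finite_setOf_weight_eq (n := n) (p := p) μ
  set s := hfin.toFinset.image shapeKey
  have hmem (k : Fin s.card) : ∃ A : Tableau n p, A.weight = μ ∧
      A.shapeKey = s.orderEmbOfFin rfl k := by
    obtain ⟨A, hA, hk⟩ := Finset.mem_image.mp (s.orderEmbOfFin_mem rfl k)
    exact ⟨A, hfin.mem_toFinset.mp hA, hk⟩
  choose A hA hkey using hmem
  refine ⟨s.card, A, fun k l hkl => ?_, Set.Subset.antisymm ?_ fun T hT => ?_⟩
  · rw [lt_iff_shapeKey_lt ((hA k).trans (hA l).symm), hkey, hkey]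
    exact (s.orderEmbOfFin rfl).strictMono hkl
  · rintro _ ⟨k, rfl⟩
    exact hA k
  · have hTs : T.shapeKey ∈ Set.range (s.orderEmbOfFin rfl) := by
      rw [Finset.range_orderEmbOfFin]
      exact Finset.mem_image_of_mem _ (hfin.mem_toFinset.mpr hT)
    obtain ⟨k, hk⟩ := hTs
    exact ⟨k, shapeKey_injective ((hkey k).trans hk)⟩

theorem exists_entry_lt_iff {H : ℕ → ℕ → ℕ} (h0 : H 0 = 0) (hH : Monotone H) (n r c : ℕ) :
    ∃ a, (H n r ≤ c → a = 0) ∧ (c < H n r → ∀ k, a < k ↔ c < H k r) := by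
  classical
  obtain hc | hc := lt_or_ge c (H n r)
  · have hex : ∃ k, c < H (k + 1) r := ⟨n, hc.trans_le (hH n.le_succ r)⟩
    refine ⟨Nat.find hex, fun h => absurd hc h.not_gt, fun _ k => ?_⟩
    cases k with
    | zero => simp [h0]
    | succ k =>
      rw [Nat.lt_succ_iff, Nat.find_le_iff]
      exact ⟨fun ⟨m, hm, hlt⟩ => hlt.trans_le (hH (Nat.succ_le_succ hm) r), fun h => ⟨k, le_rfl, h⟩⟩
  · exact ⟨0, fun _ => rfl, fun h => absurd h hc.not_gt⟩

theorem exists_of_interlacing {H : ℕ → ℕ → ℕ} (h0 : H 0 = 0) (hH : Monotone H)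
    (hlat : ∀ k r, H (k + 1) (r + 1) ≤ H k r) (hn : ∀ k, H k ≤ H n) (hp : H n p = 0) :
    ∃ A : Tableau n p, ∀ k, (A.subshape k).rowLen = H k := by
  have hanti (k : ℕ) : Antitone (H k) :=
    antitone_nat_of_succ_le fun r => (hH k.le_succ (r + 1)).trans (hlat k r)
  obtain ⟨κ, hκ⟩ := exists_youngDiagram_rowLen_eq (hanti n) hp
  have hmem (r c : ℕ) : (r, c) ∈ κ ↔ c < H n r := by rw [YoungDiagram.mem_iff_lt_rowLen, hκ]
  choose a hzero ha using fun r c => exists_entry_lt_iff h0 hH n r c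
  have hlt {r c : ℕ} (hrc : (r, c) ∈ κ) (k : ℕ) : a r c < k ↔ c < H k r :=
    ha r c ((hmem r c).mp hrc) k
  let T : SemistandardYoungTableau κ :=
    { entry := a
      row_weak' := fun {r c c'} hc hrc => by
        rw [← Nat.lt_succ_iff, hlt (κ.up_left_mem le_rfl hc.le hrc)]
        exact hc.trans ((hlt hrc _).mp (Nat.lt_succ_self _))
      col_strict' := fun {r r' c} hr hrc => by
        rw [hlt (κ.up_left_mem hr.le le_rfl hrc)]
        exact ((hlt hrc _).mp (Nat.lt_succ_self _)).trans_le ((hanti _ hr).trans (hlat _ _))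
      zeros' := fun {r c} hrc => hzero r c (not_lt.mp (mt (hmem r c).mpr hrc)) }
  refine ⟨⟨κ, T, fun {r c} hrc => (hlt hrc n).mpr ((hmem r c).mp hrc), ?_⟩, fun k => ?_⟩
  · by_contra! h
    simpa [hp] using (hmem p 0).mp (YoungDiagram.mem_iff_lt_colLen.mpr h)
  · refine funext fun r => eq_of_forall_lt_iff fun c => ?_
    rw [← YoungDiagram.mem_iff_lt_rowLen, mem_subshape]
    exact ⟨fun ⟨hrc, h⟩ => (hlt hrc k).mp h, fun h =>
      have hrc := (hmem r c).mpr (h.trans_le (hn k r))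
      ⟨hrc, (hlt hrc k).mpr h⟩⟩

theorem exists_exponent_eq {γ : Fin n × Fin p →₀ ℕ} (hγ : IsBallot γ) :
    ∃ A : Tableau n p, A.exponent = γ := by
  obtain ⟨A, hA⟩ := exists_of_interlacing (columnCount_zero_left γ) (columnCount_mono γ)
    hγ.columnCount_succ_le (columnCount_le γ) (columnCount_eq_zero γ n le_rfl)
  exact ⟨A, columnCount_injective (funext fun k => (columnCount_exponent A k).trans (hA k))⟩

end Tableau

/-! ### Tableau vectors and their leading terms -/

theorem sum_cells_eq {M : Type*} [AddCommMonoid M] (κ : YoungDiagram) (g : κ.cells → M) :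
    ∑ b, g b = ∑ c : Fin (κ.rowLen 0), ∑ r : Fin (κ.colLen c),
      g ⟨(r, c), (YoungDiagram.mem_cells _).mpr (YoungDiagram.mem_iff_lt_colLen.mpr r.isLt)⟩ := by
  let box (x : Σ c : Fin (κ.rowLen 0), Fin (κ.colLen c)) : κ.cells :=
    ⟨(x.2, x.1), (YoungDiagram.mem_cells _).mpr (YoungDiagram.mem_iff_lt_colLen.mpr x.2.isLt)⟩
  have hbox : Function.Bijective box := by
    constructor
    · rintro ⟨c, r⟩ ⟨c', r'⟩ h
      obtain ⟨hr, hc⟩ := Prod.ext_iff.mp (Subtype.ext_iff.mp h)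
      obtain rfl := Fin.ext hc
      obtain rfl := Fin.ext hr
      rfl
    · rintro ⟨⟨r, c⟩, hb⟩
      rw [YoungDiagram.mem_cells] at hb
      exact ⟨⟨⟨c, YoungDiagram.mem_iff_lt_rowLen.mp (κ.up_left_mem r.zero_le le_rfl hb)⟩,
        ⟨r, YoungDiagram.mem_iff_lt_colLen.mp hb⟩⟩, rfl⟩
  rw [← hbox.sum_comp g, Fintype.sum_sigma]

namespace Tableau

variable {n p : ℕ}

theorem column_strictMono (A : Tableau n p) (c : ℕ) : StrictMono (A.column c) := fun _ s hrs =>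
  A.entry.col_strict hrs (YoungDiagram.mem_iff_lt_colLen.mpr s.isLt)

theorem colLen_le (A : Tableau n p) (c : ℕ) : A.shape.colLen c ≤ p :=
  (A.shape.colLen_anti 0 c c.zero_le).trans A.length_le

/-- The part of the leading term that comes from the first `m` columns. -/
def leadingPart (A : Tableau n p) (m : ℕ) : CliffPoly n p :=
  (List.range m).foldl (fun v c => columnTerm (A.column c) (Fin.castLE (A.colLen_le c)) v)
    (vac n p)

/-- The exponent of the `x`-part of `leadingPart`. -/
def partExponent (A : Tableau n p) (m : ℕ) : Fin n × Fin p →₀ ℕ :=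
  ∑ c ∈ Finset.range m, columnExponent (A.column c) (Fin.castLE (A.colLen_le c))

/-- The normalized tableau vector of the tableau formed by the first `m` columns. -/
def omegaPart (A : Tableau n p) (m : ℕ) : CliffPoly n p :=
  (List.range m).foldl (fun v c => columnSum (A.column c) v) (vac n p)

theorem leadingPart_succ (A : Tableau n p) (m : ℕ) :
    A.leadingPart (m + 1)
      = columnTerm (A.column m) (Fin.castLE (A.colLen_le m)) (A.leadingPart m) := by
  simp [leadingPart, List.range_succ]

theorem omegaPart_succ (A : Tableau n p) (m : ℕ) :
    A.omegaPart (m + 1) = columnSum (A.column m) (A.omegaPart m) := by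
  simp [omegaPart, List.range_succ]

theorem partExponent_succ (A : Tableau n p) (m : ℕ) :
    A.partExponent (m + 1)
      = A.partExponent m + columnExponent (A.column m) (Fin.castLE (A.colLen_le m)) :=
  Finset.sum_range_succ _ _

theorem leadingPart_eq_smul (A : Tableau n p) (m : ℕ) :
    ∃ z : ℤˣ, A.leadingPart m = (z : ℤ) •
      monomialBasis n p (A.partExponent m, columnParity (A.partExponent m)) := by
  induction m with
  | zero => exact ⟨1, by simp [leadingPart, partExponent, vac_eq_monomialBasis]⟩
  | succ m ih =>
    obtain ⟨z, hz⟩ := ih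
    obtain ⟨z', hz'⟩ := columnTerm_monomialBasis (A.column m) (Fin.castLE (A.colLen_le m))
      (A.partExponent m, columnParity (A.partExponent m))
    refine ⟨z * z', ?_⟩
    rw [leadingPart_succ, hz, map_zsmul, hz', smul_smul, partExponent_succ, map_add,
      Units.val_mul]

theorem leadingPart_eq_tmul (A : Tableau n p) (m : ℕ) :
    A.leadingPart m = MvPolynomial.monomial (A.partExponent m) 1 ⊗ₜ[ℂ]
      (List.ofFn fun c : Fin m =>
        (List.ofFn fun r => (e (Fin.castLE (A.colLen_le c) r) : Cl p)).prod).reverse.prod := by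
  induction m with
  | zero => simp [leadingPart, partExponent, vac]
  | succ m ih =>
    rw [leadingPart_succ, ih, columnTerm_eq_map, TensorProduct.map_tmul, LinearMap.mulLeft_apply,
      LinearMap.mulLeft_apply, MvPolynomial.monomial_mul, one_mul, partExponent_succ,
      add_comm (A.partExponent m), List.ofFn_succ', List.concat_eq_append, List.reverse_append,
      List.reverse_singleton, List.singleton_append, List.prod_cons]
    rfl

theorem omegaPart_sub_leadingPart_mem (A : Tableau n p) (m : ℕ) :
    A.omegaPart m - A.leadingPart m ∈ supportedOn (dominated (A.partExponent m)) := by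
  induction m with
  | zero =>
    rw [show A.omegaPart 0 = A.leadingPart 0 from rfl, sub_self]
    exact Submodule.zero_mem _
  | succ m ih =>
    obtain ⟨z, hz⟩ := leadingPart_eq_smul A m
    have hlead := Submodule.smul_of_tower_mem _ (z : ℤ) <| columnSum_sub_columnTerm_mem
      (A.column_strictMono m) (A.colLen_le m) (A.partExponent m, columnParity (A.partExponent m))
    have hrest :=
      columnSum_mem_supportedOn_dominated (A.column_strictMono m).monotone (A.colLen_le m) ih
    rw [smul_sub, ← map_zsmul (columnSum _), ← map_zsmul (columnTerm _ _), ← hz,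
      ← leadingPart_succ] at hlead
    rw [map_sub, ← omegaPart_succ] at hrest
    rw [partExponent_succ, ← sub_add_sub_cancel]
    exact Submodule.add_mem _ hrest hlead

theorem omegaPart_mem_integralVectors (A : Tableau n p) (m : ℕ) :
    A.omegaPart m ∈ integralVectors n p := by
  induction m with
  | zero =>
    rw [show A.omegaPart 0 = vac n p from rfl, vac_eq_monomialBasis]
    exact monomialBasis_mem_integralVectors _
  | succ m ih =>
    rw [omegaPart_succ]
    exact columnSum_mem_integralVectors _ ih

theorem foldl_columnOp_eq_smul (A : Tableau n p) (m : ℕ) :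
    (List.range m).foldl (fun v c => columnOp (A.column c) v) (vac n p)
      = (∏ c ∈ Finset.range m, ((A.shape.colLen c).factorial : ℂ)) • A.omegaPart m := by
  induction m with
  | zero => simp [omegaPart]
  | succ m ih =>
    rw [List.range_succ, List.foldl_append, ih, List.foldl_cons, List.foldl_nil, columnOp_eq,
      map_smul, LinearMap.smul_apply, smul_smul, Finset.prod_range_succ, omegaPart_succ]

theorem omegaTilde_eq (A : Tableau n p) : A.omegaTilde = A.omegaPart (A.shape.rowLen 0) := by
  have hne : (A.shapeFactorial : ℂ) ≠ 0 := by
    rw [shapeFactorial, Nat.cast_ne_zero, Finset.prod_ne_zero_iff]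
    exact fun c _ => Nat.factorial_ne_zero _
  rw [omegaTilde, omega, foldl_columnOp_eq_smul, ← Nat.cast_prod, ← shapeFactorial,
    inv_smul_smul₀ hne]

theorem partExponent_eq (A : Tableau n p) : A.partExponent (A.shape.rowLen 0) = A.exponent := by
  rw [exponent, sum_cells_eq, partExponent, Finset.sum_range]
  rfl

theorem leadingTerm_eq (A : Tableau n p) :
    A.leadingTerm = A.leadingPart (A.shape.rowLen 0) := by
  rw [leadingPart_eq_tmul, partExponent_eq, leadingTerm, exponent, MvPolynomial.monomial_sum_one]
  rfl

theorem leadingTerm_eq_smul (A : Tableau n p) :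
    ∃ z : ℤˣ, A.leadingTerm
      = (z : ℤ) • monomialBasis n p (A.exponent, columnParity A.exponent) := by
  rw [leadingTerm_eq, ← partExponent_eq]
  exact A.leadingPart_eq_smul _

theorem omegaTilde_sub_leadingTerm_mem (A : Tableau n p) :
    A.omegaTilde - A.leadingTerm ∈ supportedOn (dominated A.exponent) := by
  rw [omegaTilde_eq, leadingTerm_eq, ← partExponent_eq]
  exact omegaPart_sub_leadingPart_mem A _

theorem omegaTilde_mem_integralVectors (A : Tableau n p) :
    A.omegaTilde ∈ integralVectors n p := by
  rw [omegaTilde_eq]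
  exact omegaPart_mem_integralVectors A _

theorem omegaTilde_mem_L (A : Tableau n p) : A.omegaTilde ∈ L n p := by
  refine Submodule.smul_mem _ _ ?_
  rw [omega]
  generalize A.shape.rowLen 0 = m
  induction m with
  | zero => exact vac_mem_L
  | succ m ih =>
    rw [List.range_succ, List.foldl_append, List.foldl_cons, List.foldl_nil]
    exact columnOp_mem_L _ ih

theorem omegaTilde_mem_weightSpace (A : Tableau n p) :
    A.omegaTilde ∈ weightSpace n p A.weight := by
  refine mem_weightSpace.mpr ⟨A.omegaTilde_mem_L, ?_⟩
  obtain ⟨z, hz⟩ := A.leadingTerm_eq_smul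
  have hlead : A.leadingTerm ∈ supportedOn {b : MonomialIndex n p | rowDegree b.1 = A.weight} := by
    rw [hz]
    exact Submodule.smul_of_tower_mem _ _ (monomialBasis_mem_supportedOn A.rowDegree_exponent)
  have hrest := supportedOn_mono (S' := {b | rowDegree b.1 = A.weight})
    (fun _ hb => hb.2.trans A.rowDegree_exponent) A.omegaTilde_sub_leadingTerm_mem
  simpa only [sub_add_cancel] using Submodule.add_mem _ hrest hlead

end Tableau

/-! ### Expansions in tableau vectors -/

theorem linearIndependent_of_triangular {ι R M α : Type*} [Ring R] [AddCommGroup M] [Module R M]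
    [PartialOrder α] {v : ι → M} (φ : ι → M →ₗ[R] R) (key : ι → α) (hdiag : ∀ i, φ i (v i) = 1)
    (hlt : ∀ i j, i ≠ j → φ i (v j) ≠ 0 → key i < key j) : LinearIndependent R v := by
  classical
  rw [linearIndependent_iff]
  intro c hc
  by_contra h
  obtain ⟨_, hmax⟩ := (c.support.image key).exists_maximal
    ((Finsupp.support_nonempty_iff.mpr h).image _)
  obtain ⟨i, hi, rfl⟩ := Finset.mem_image.mp hmax.1
  have hcoeff : φ i (Finsupp.linearCombination R v c) = c i := by
    rw [Finsupp.linearCombination_apply, Finsupp.sum, map_sum, Finset.sum_eq_single_of_mem i hi]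
    · rw [map_smul, hdiag, smul_eq_mul, mul_one]
    · intro j hj hji
      rw [map_smul]
      by_contra hne
      exact hmax.not_gt (Finset.mem_image_of_mem _ hj)
        (hlt i j hji.symm (right_ne_zero_of_smul hne))
  rw [hc, map_zero] at hcoeff
  exact Finsupp.mem_support_iff.mp hi hcoeff.symm

section Pairing

variable {n p : ℕ}

/-- The linear form `⟨u, ·⟩`. -/
def pairingForm (u : CliffPoly n p) : CliffPoly n p →ₗ[ℂ] ℂ where
  toFun v := pairing u v
  map_add' v w := by simp [pairing, mul_add, Finsupp.sum_add]
  map_smul' a v := by simp [pairing, Finsupp.mul_sum, mul_left_comm]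

theorem pairingForm_apply (u v : CliffPoly n p) : pairingForm u v = pairing u v := rfl

theorem pairing_zsmul_monomialBasis (z : ℤ) (b : MonomialIndex n p) (v : CliffPoly n p) :
    pairing (z • monomialBasis n p b) v = z * (monomialBasis n p).repr v b := by
  rw [pairing, map_zsmul, Module.Basis.repr_self, Finsupp.smul_single, zsmul_one,
    Finsupp.sum_single_index (by simp), map_intCast]

theorem pairing_leadingTerm_eq_intCast (A : Tableau n p) {v : CliffPoly n p}
    (hv : v ∈ integralVectors n p) : ∃ z : ℤ, pairing A.leadingTerm v = z := by
  obtain ⟨z, hz⟩ := A.leadingTerm_eq_smul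
  obtain ⟨z', hz'⟩ := mem_integralVectors.mp hv (A.exponent, columnParity A.exponent)
  exact ⟨z * z', by rw [hz, pairing_zsmul_monomialBasis, hz', Int.cast_mul]⟩

theorem pairing_leadingTerm_self (A : Tableau n p) : pairing A.leadingTerm A.leadingTerm = 1 := by
  obtain ⟨z, hz⟩ := A.leadingTerm_eq_smul
  rw [hz, pairing_zsmul_monomialBasis, map_zsmul, Module.Basis.repr_self, Finsupp.smul_single,
    Finsupp.single_eq_same, zsmul_one, ← Int.cast_mul, Int.units_coe_mul_self, Int.cast_one]

theorem pairing_leadingTerm_of_ne {A B : Tableau n p} (hAB : A ≠ B) :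
    pairing A.leadingTerm B.leadingTerm = 0 := by
  obtain ⟨z, hz⟩ := A.leadingTerm_eq_smul
  obtain ⟨z', hz'⟩ := B.leadingTerm_eq_smul
  have hne : (B.exponent, columnParity B.exponent) ≠ (A.exponent, columnParity A.exponent) :=
    fun h => hAB (Tableau.exponent_injective (Prod.ext_iff.mp h).1.symm)
  rw [hz, pairing_zsmul_monomialBasis, hz', map_zsmul, Module.Basis.repr_self,
    Finsupp.smul_single, Finsupp.single_eq_of_ne' hne, mul_zero]

theorem pairing_leadingTerm_omegaTilde (A B : Tableau n p) :
    pairing A.leadingTerm B.omegaTilde = pairing A.leadingTerm B.leadingTerm +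
      pairing A.leadingTerm (B.omegaTilde - B.leadingTerm) := by
  simp only [← pairingForm_apply, ← map_add, add_sub_cancel]

theorem cornerSum_lt_of_pairing_sub_ne_zero {A B : Tableau n p}
    (h : pairing A.leadingTerm (B.omegaTilde - B.leadingTerm) ≠ 0) :
    cornerSum A.exponent < cornerSum B.exponent := by
  obtain ⟨z, hz⟩ := A.leadingTerm_eq_smul
  rw [hz, pairing_zsmul_monomialBasis] at h
  exact (mem_supportedOn.mp B.omegaTilde_sub_leadingTerm_mem _ (right_ne_zero_of_mul h)).1

theorem pairing_leadingTerm_omegaTilde_self (A : Tableau n p) :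
    pairing A.leadingTerm A.omegaTilde = 1 := by
  rw [pairing_leadingTerm_omegaTilde, pairing_leadingTerm_self, add_eq_left]
  exact not_imp_comm.mp cornerSum_lt_of_pairing_sub_ne_zero (lt_irrefl _)

theorem cornerSum_lt_of_pairing_ne_zero {A B : Tableau n p} (hAB : A ≠ B)
    (h : pairing A.leadingTerm B.omegaTilde ≠ 0) :
    cornerSum A.exponent < cornerSum B.exponent := by
  rw [pairing_leadingTerm_omegaTilde, pairing_leadingTerm_of_ne hAB, zero_add] at h
  exact cornerSum_lt_of_pairing_sub_ne_zero h

theorem linearIndependent_omegaTilde :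
    LinearIndependent ℂ (Tableau.omegaTilde : Tableau n p → CliffPoly n p) :=
  linearIndependent_of_triangular (fun A => pairingForm A.leadingTerm)
    (fun A => cornerSum A.exponent) pairing_leadingTerm_omegaTilde_self
    fun _ _ => cornerSum_lt_of_pairing_ne_zero

theorem eq_zero_of_pairing_leadingTerm {μ : Fin n → ℕ} {v : CliffPoly n p}
    (hv : v ∈ weightSpace n p μ)
    (h : ∀ A : Tableau n p, A.weight = μ → pairing A.leadingTerm v = 0) : v = 0 := by
  by_contra hv0
  obtain ⟨hL, hw⟩ := mem_weightSpace.mp hv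
  obtain ⟨⟨γ, η⟩, hb, hballot⟩ := exists_ballot_monomial hL hv0
  obtain ⟨A, rfl⟩ := Tableau.exists_exponent_eq hballot
  have hweight : rowDegree A.exponent = μ := mem_supportedOn.mp hw _ hb
  obtain rfl : η = columnParity A.exponent :=
    mem_supportedOn.mp (L_le_supportedOn_columnParity hL) _ hb
  obtain ⟨z, hz⟩ := A.leadingTerm_eq_smul
  have hpair := h A (A.rowDegree_exponent.symm.trans hweight)
  rw [hz, pairing_zsmul_monomialBasis] at hpair
  exact mul_ne_zero (Int.cast_ne_zero.mpr z.ne_zero) hb hpair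

end Pairing

section Expansion

variable {n p d : ℕ} {μ : Fin n → ℕ} {A : Fin d → Tableau n p}

theorem IsEnumeration.weight_eq (hA : IsEnumeration μ A) (k : Fin d) : (A k).weight = μ :=
  hA.2.subset (Set.mem_range_self k)

theorem transitionMatrix_eq_intCast (k l : Fin d) : ∃ z : ℤ, transitionMatrix A k l = z :=
  pairing_leadingTerm_eq_intCast _ (A l).omegaTilde_mem_integralVectors

theorem isUnitriangular_transitionMatrix (hA : IsEnumeration μ A) :
    IsUnitriangular (transitionMatrix A) where
  diag _ := pairing_leadingTerm_omegaTilde_self _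
  upper k l (hlk : l < k) := by
    have hweight : (A k).weight = (A l).weight := (hA.weight_eq k).trans (hA.weight_eq l).symm
    have hlt : A l < A k := hA.1 l k hlk
    have hne : A k ≠ A l := fun heq =>
      Tableau.not_lt_of_cornerSum_le hweight (by rw [heq]) hlt
    by_contra h
    exact Tableau.not_lt_of_cornerSum_le hweight (cornerSum_lt_of_pairing_ne_zero hne h).le hlt

theorem leadingCoeffs_sum (g : Fin d → ℂ) :
    leadingCoeffs A (∑ k, g k • (A k).omegaTilde) = (transitionMatrix A).mulVec g := by
  funext k
  rw [leadingCoeffs, ← pairingForm_apply, map_sum, Matrix.mulVec, dotProduct]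
  refine Finset.sum_congr rfl fun l _ => ?_
  rw [map_smul, pairingForm_apply, smul_eq_mul, mul_comm]
  rfl

theorem sum_mem_weightSpace (hA : IsEnumeration μ A) (g : Fin d → ℂ) :
    ∑ k, g k • (A k).omegaTilde ∈ weightSpace n p μ :=
  Submodule.sum_mem _ fun k _ => Submodule.smul_mem _ _ <|
    hA.weight_eq k ▸ (A k).omegaTilde_mem_weightSpace

theorem eq_of_leadingCoeffs_eq (hA : IsEnumeration μ A) {v w : CliffPoly n p}
    (hv : v ∈ weightSpace n p μ) (hw : w ∈ weightSpace n p μ)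
    (h : leadingCoeffs A v = leadingCoeffs A w) : v = w := by
  rw [← sub_eq_zero]
  refine eq_zero_of_pairing_leadingTerm (Submodule.sub_mem _ hv hw) fun B hB => ?_
  obtain ⟨k, rfl⟩ := hA.2.superset hB
  rw [← pairingForm_apply, map_sub, sub_eq_zero]
  exact congrFun h k

theorem eq_sum_of_mulVec_eq (hA : IsEnumeration μ A) {v : CliffPoly n p}
    (hv : v ∈ weightSpace n p μ) {g : Fin d → ℂ}
    (hg : (transitionMatrix A).mulVec g = leadingCoeffs A v) :
    v = ∑ k, g k • (A k).omegaTilde :=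
  eq_of_leadingCoeffs_eq hA hv (sum_mem_weightSpace hA g) (by rw [leadingCoeffs_sum, hg])

theorem eq_sum_chainSum (hA : IsEnumeration μ A) {v : CliffPoly n p}
    (hv : v ∈ weightSpace n p μ) :
    v = ∑ k, chainSum (transitionMatrix A) (leadingCoeffs A v) k • (A k).omegaTilde :=
  eq_sum_of_mulVec_eq hA hv ((isUnitriangular_transitionMatrix hA).mulVec_chainSum _)

theorem eq_sum_inv_mulVec (hA : IsEnumeration μ A) {v : CliffPoly n p}
    (hv : v ∈ weightSpace n p μ) :
    v = ∑ k, ((transitionMatrix A)⁻¹.mulVec (leadingCoeffs A v)) k • (A k).omegaTilde := by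
  have hdet : IsUnit (transitionMatrix A).det :=
    (isUnitriangular_transitionMatrix hA).det_eq_one ▸ isUnit_one
  refine eq_sum_of_mulVec_eq hA hv ?_
  rw [Matrix.mulVec_mulVec, Matrix.mul_nonsing_inv _ hdet, Matrix.one_mulVec]

theorem dimWeight_eq (hA : IsEnumeration μ A) : dimWeight n p μ = d := by
  let φ : weightSpace n p μ →ₗ[ℂ] (Fin d → ℂ) :=
    (LinearMap.pi fun k => pairingForm (A k).leadingTerm) ∘ₗ (weightSpace n p μ).subtype
  have hinj : Function.Injective φ := fun v w h =>
    Subtype.ext (eq_of_leadingCoeffs_eq hA v.2 w.2 h)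
  have hsurj : Function.Surjective φ := fun f =>
    ⟨⟨_, sum_mem_weightSpace hA (chainSum (transitionMatrix A) f)⟩,
      (leadingCoeffs_sum _).trans ((isUnitriangular_transitionMatrix hA).mulVec_chainSum f)⟩
  rw [dimWeight, (LinearEquiv.ofBijective φ ⟨hinj, hsurj⟩).finrank_eq, Module.finrank_fin_fun]

theorem exists_intCast_expansion {v : CliffPoly n p} (hv : v ∈ weightSpace n p μ)
    (hint : v ∈ integralVectors n p) :
    ∃ c : Tableau n p →₀ ℤ, v = c.sum (fun B z => (z : ℂ) • B.omegaTilde) := by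
  obtain ⟨d, A, hA⟩ := Tableau.exists_isEnumeration (n := n) (p := p) μ
  have hcoeff : ∀ k, chainSum (transitionMatrix A) (leadingCoeffs A v) k
      ∈ (Int.castRingHom ℂ).range := by
    refine chainSum_mem _ (fun k l => ?_) fun k => ?_
    · obtain ⟨z, hz⟩ := transitionMatrix_eq_intCast (A := A) k l
      exact ⟨z, hz.symm⟩
    · obtain ⟨z, hz⟩ := pairing_leadingTerm_eq_intCast (A k) hint
      exact ⟨z, hz.symm⟩
  choose z hz using hcoeff
  refine ⟨∑ k, Finsupp.single (A k) (z k), ?_⟩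
  rw [← Finsupp.sum_finsetSum_index (by simp) (by intros; rw [Int.cast_add, add_smul])]
  conv_lhs => rw [eq_sum_chainSum hA hv]
  refine Finset.sum_congr rfl fun k _ => ?_
  rw [← hz, Finsupp.sum_single_index (by simp), eq_intCast]

theorem existsUnique_intCast_expansion {v : CliffPoly n p} (hv : v ∈ weightSpace n p μ)
    (hint : v ∈ integralVectors n p) :
    ∃ c : Tableau n p →₀ ℤ, v = c.sum (fun B z => (z : ℂ) • B.omegaTilde) ∧
      ∀ c' : Tableau n p →₀ ℂ, v = c'.sum (fun B z => z • B.omegaTilde) →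
        ∀ B, c' B = (c B : ℂ) := by
  obtain ⟨c, hc⟩ := exists_intCast_expansion hv hint
  refine ⟨c, hc, fun c' hc' B => ?_⟩
  have heq : c' = c.mapRange (Int.cast : ℤ → ℂ) Int.cast_zero := by
    refine linearIndependent_omegaTilde.finsuppLinearCombination_injective ?_
    rw [Finsupp.linearCombination_apply, Finsupp.linearCombination_apply,
      Finsupp.sum_mapRange_index (by simp), ← hc, ← hc']
  rw [heq, Finsupp.mapRange_apply]

theorem X_mem_weightSpace (i : Fin n) {v : CliffPoly n p} (hv : v ∈ weightSpace n p μ) :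
    X i v ∈ weightSpace n p (μ + Pi.single i 1) := by
  obtain ⟨hL, hw⟩ := mem_weightSpace.mp hv
  refine mem_weightSpace.mpr ⟨X_mem_L i hL, X_mem_supportedOn i (fun b hb α => ?_) hw⟩
  rw [Set.mem_ofPred_eq, map_add, rowDegree_single, Set.mem_ofPred_eq.mp hb]

theorem D_mem_weightSpace (i : Fin n) {v : CliffPoly n p} (hv : v ∈ weightSpace n p μ) :
    D i v ∈ weightSpace n p (μ - Pi.single i 1) := by
  obtain ⟨hL, hw⟩ := mem_weightSpace.mp hv
  refine mem_weightSpace.mpr ⟨D_mem_L i hL, D_mem_supportedOn i (fun b hb α hα => ?_) hw⟩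
  have hle : Finsupp.single (i, α) 1 ≤ b.1 :=
    Finsupp.single_le_iff.mpr (Nat.one_le_iff_ne_zero.mpr hα)
  have hdegree : rowDegree (b.1 - Finsupp.single (i, α) 1) + Pi.single i 1 = μ := by
    rw [← rowDegree_single i α, ← map_add, tsub_add_cancel_of_le hle, Set.mem_ofPred_eq.mp hb]
  rw [Set.mem_ofPred_eq, ← hdegree, add_tsub_cancel_right]

end Expansion

end

end Paraboson

open Paraboson in
theorem proposition6p1 (n p : ℕ) (hn : 0 < n) (hp : 0 < p) :
    -- for every weight, the tableaux are `d_μ` in number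
    (∀ μ : Fin n → ℕ, ∃ A : Fin (dimWeight n p μ) → Tableau n p, IsEnumeration μ A) ∧
    (∀ (μ : Fin n → ℕ) (A : Fin (dimWeight n p μ) → Tableau n p), IsEnumeration μ A →
      -- `U_μ` is an integer matrix
      (∀ k l, ∃ z : ℤ, transitionMatrix A k l = (z : ℂ)) ∧
      -- `U_μ` is upper unitriangular
      (∀ k, transitionMatrix A k k = 1) ∧
      (∀ k l, l < k → transitionMatrix A k l = 0) ∧
      -- the expansion of the vectors of weight `μ + p/2`
      (∀ v ∈ weightSpace n p μ,
        v = ∑ k, ((transitionMatrix A)⁻¹.mulVec (leadingCoeffs A v)) k • (A k).omegaTilde ∧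
        v = ∑ k : Fin (dimWeight n p μ),
              ∑ t ∈ Finset.range (dimWeight n p μ - (k : ℕ)), ∑ l ∈ chains k t,
                ((-1 : ℂ) ^ t * (∏ s : Fin t, transitionMatrix A (l s.castSucc) (l s.succ)) *
                  leadingCoeffs A v (l (Fin.last t))) • (A k).omegaTilde)) ∧
    -- the coefficients in the expansions of `X_i ω̃_A` and `D_i ω̃_A` are well defined integers
    (∀ (i : Fin n) (A : Tableau n p), ∀ F ∈ ({X i, D i} : Set (Module.End ℂ (CliffPoly n p))),
      ∃ c : Tableau n p →₀ ℤ,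
        F A.omegaTilde = c.sum (fun B z => (z : ℂ) • B.omegaTilde) ∧
        ∀ c' : Tableau n p →₀ ℂ, F A.omegaTilde = c'.sum (fun B z => z • B.omegaTilde) →
          ∀ B, c' B = (c B : ℂ)) := by
  refine ⟨fun μ => ?_, fun μ A hA => ?_, fun i A F hF => ?_⟩
  · obtain ⟨d, A, hA⟩ := Tableau.exists_isEnumeration (n := n) (p := p) μ
    obtain rfl := dimWeight_eq hA
    exact ⟨A, hA⟩
  · have hU := isUnitriangular_transitionMatrix hA
    refine ⟨transitionMatrix_eq_intCast, hU.diag, fun k l h => hU.upper h, fun v hv =>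
      ⟨eq_sum_inv_mulVec hA hv, ?_⟩⟩
    simpa only [chainSum, chainTerm, Finset.sum_smul] using eq_sum_chainSum hA hv
  · rcases hF with rfl | rfl
    · exact existsUnique_intCast_expansion (X_mem_weightSpace i A.omegaTilde_mem_weightSpace)
        (X_mem_integralVectors i A.omegaTilde_mem_integralVectors)
    · exact existsUnique_intCast_expansion (D_mem_weightSpace i A.omegaTilde_mem_weightSpace)
        (D_mem_integralVectors i A.omegaTilde_mem_integralVectors)
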